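/- **Setting.** Let $\lambda,\Delta t>0$, $\Delta x=\lambda\Delta t$. The D3Q27 scheme has the 27 velocities $v\in\{-\lambda,0,\lambda\}^3$; with $v=(x,y,z)$, $n=|v|^2$, its moments $m_k=\sum_v p_k(v)f_v$ ($0\le k\le 26$) are defined by $p_0=1$; $p_{1,2,3}=x,y,z$; $p_4=n-2\lambda^2$ ($\varepsilon$); $p_5=2x^2-y^2-z^2$, $p_6=y^2-z^2$ ($XX,WW$); $p_{7,8,9}=xy,yz,zx$; $p_{10,11,12}=(x,y,z)(3n-7\lambda^2)$ ($q$); $p_{13,14,15}=\tfrac12(x,y,z)(9n^2-39\lambda^2n+38\lambda^4)$ ($r$); $p_{16}=\tfrac12(3n^2-11\lambda^2n+8\lambda^4)$ ($\varepsilon_2$); $p_{17}=\tfrac12(9n^3-45\lambda^2n^2+60\lambda^4n-16\lambda^6)$ ($\varepsilon_3$); $p_{18}=(3n-5\lambda^2)p_5$, $p_{19}=(3n-5\lambda^2)p_6$ ($XX_e,WW_e$); $p_{20,21,22}=(3n-8\lambda^2)(xy,yz,zx)$; $p_{23,24,25}=x(y^2-z^2),\,y(z^2-x^2),\,z(x^2-y^2)$;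 $p_{26}=xyz$. Let $M$ be the resulting $27\times27$ matrix. The conserved moments are $W=(\rho,J)=(m_0;m_1,m_2,m_3)$. The others, $Y=(m_4,\dots,m_{26})$, relax by $m_k^*=m_k+s_k(m_k^{eq}-m_k)$ with $s_k\neq0$, towards a linear equilibrium $Y^{eq}=EW$: $\varepsilon^{eq}=\alpha\lambda^2\rho$, $q^{eq}=-2\lambda^2J$, $r^{eq}=2\lambda^4J$, $\varepsilon_2^{eq}=-(2+3\alpha)\lambda^4\rho$, $\varepsilon_3^{eq}=\gamma\lambda^6\rho$ ($\gamma$ arbitrary), and all other $m_k^{eq}$ are zero; then $f_v(X,t+\Delta t)=f_v^*(X-v\Delta t,t)$ with $Mf^*=m^*$. Put $\sigma_k=\frac1{s_k}-\frac12$. Its formal equivalent equations are $\partial_tW=\sum_{j\ge1}\Delta t^{j-1}\alpha_jW$, $Y=\big(E+\sum_{j\ge1}\Delta t^j\beta_j\big)W$, where the matrices $\alpha_j,\beta_j$ of constant-coefficient space differential operators of order $j$ are obtained by identifying the powers of $\Delta t$ in the Taylor expansion of the scheme; truncation at order $4$ means keeping $j\le4$. **Family.** Let $\sigma_5\ne0$,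 $\psi=\sigma_{18}/\sigma_5$, $D=3\psi^3-22\psi^2+23\psi+14$, $Q=3\psi^2-11\psi+14$ (note $Q>0$). Assume $2+3\alpha\ne0$, $4\psi-7\neq0$, $D\neq0$, $\sigma_5=\sigma_6=\sigma_7=\sigma_8=\sigma_9$, $\sigma_{18}=\sigma_{19}=\psi\sigma_5$ and $$\sigma_4=\sigma_5\frac{3\psi^3-4\psi^2-13\psi+32}{D},\qquad \sigma_{10}=\sigma_{11}=\sigma_{12}=\frac1{12\sigma_5}\frac{(3\psi-7)(\psi-4)}{Q},$$ $$\sigma_{23}=\sigma_{24}=\sigma_{25}=\frac1{12\sigma_5}\frac{3\psi^2-7\psi+16}{Q},\qquad \sigma_{26}=\frac1{48\sigma_5}\frac{21\psi^2-73\psi+100}{Q},$$ $$\sigma_{16}=\sigma_5\,\frac{6\psi^5-(36\alpha+71)\psi^4+(111\alpha+211)\psi^3+(72\alpha-195)\psi^2-(657\alpha+151)\psi+672\alpha+308}{-(2+3\alpha)(4\psi-7)D}$$ (for $\alpha=-1$: $\sigma_{16}=\sigma_5\,\frac{6\psi^5-35\psi^4+100\psi^3-267\psi^2+506\psi-364}{(4\psi-7)D}$).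 The remaining $s_k$ ($13\le k\le15$, $k=17$, $20\le k\le22$) are arbitrary nonzero numbers. **Isotropy at order four.** The matrix $M$ is invertible, and the equivalent equations truncated at order $4$ are invariant by rotation, i.e. of the form $\partial_t\rho+\sum_k(a_k\Delta^k\rho+b_k\,\mathrm{div}\,\Delta^kJ)=0$, $\partial_tJ+\sum_k(d_k\nabla\Delta^k\rho+m_k\Delta^kJ+e_k\nabla\mathrm{div}\,\Delta^kJ+f_k\,\mathrm{curl}\,\Delta^kJ)=0$ with finite sums. More precisely they are exactly $$\partial_t\rho+\mathrm{div}J+\xi\Delta\,\mathrm{div}J+\eta\Delta^2\rho=0,$$ $$\partial_tJ+c_0^2\nabla\rho-\mu\Delta J-\zeta\nabla\mathrm{div}J+\chi\nabla\Delta\rho+\mu_4\Delta^2J+\zeta_4\nabla\mathrm{div}\Delta J=0,$$ with $c_0^2=\frac{\alpha+2}3\lambda^2$, $\mu=\frac13\sigma_5\lambda\Delta x$, $\zeta=\frac19\big(\sigma_5-(1+3\alpha)\sigma_4\big)\lambda\Delta x$, $\xi=\frac{\alpha-1}{36}\Delta x^2$, $\chi=\frac{\alpha+2}{54}\big(1-\alpha+6\alpha\sigma_4^2+2\sigma_4^2-8\sigma_5^2\big)\lambda^2\Delta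 x^2$, $$\eta=\frac{\sigma_5\lambda\Delta x^3}{108}\,\frac{(\alpha+2)\big(32\alpha-8-13\alpha\psi-35\psi-4\alpha\psi^2+28\psi^2+3\alpha\psi^3-3\psi^3\big)}{D},$$ $$\mu_4=\frac{\sigma_5\lambda\Delta x^3}{108}\,\frac{36\psi^2\sigma_5^2-132\psi\sigma_5^2+168\sigma_5^2+3\psi^2-\psi-8}{Q},\qquad \zeta_4=\frac1{108}\,\frac{\sigma_5\lambda\Delta x^3}{(4\psi-7)\,Q\,D^3}\,N_4,$$ $$\begin{aligned}N_4={}&(-526848 - 6082272\,\psi - 3413088\,\psi^{2} + 29925576\,\psi^{3} - 12827088\,\psi^{4} - 46884384\,\psi^{5} + 76942908\,\psi^{6} - 56568924\,\psi^{7} + 24275088\,\psi^{8} - 6400920\,\psi^{9} + 1015308\,\psi^{10} - 88452\,\psi^{11} + 3240\,\psi^{12})\\ &+ \alpha\,(2458624 + 803992\,\psi - 16250948\,\psi^{2} + 15057742\,\psi^{3} + 22678777\,\psi^{4} - 58798343\,\psi^{5} + 56334931\,\psi^{6} - 30298973\,\psi^{7} + 9787591\,\psi^{8} - 1834629\,\psi^{9}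 + 169965\,\psi^{10} - 3429\,\psi^{11} - 324\,\psi^{12})\\ &+ \alpha^2\,(2458624 + 3742816\,\psi - 12657680\,\psi^{2} - 1230152\,\psi^{3} + 25708132\,\psi^{4} - 29063324\,\psi^{5} + 13802956\,\psi^{6} - 1316084\,\psi^{7} - 1805156\,\psi^{8} + 989292\,\psi^{9} - 235980\,\psi^{10} + 27756\,\psi^{11} - 1296\,\psi^{12})\\ &+ \sigma_5^2\,(-13105344 + 100016448\,\psi - 131926368\,\psi^{2} - 10762392\,\psi^{3} + 102921792\,\psi^{4} - 287184\,\psi^{5} - 117365232\,\psi^{6} + 116153808\,\psi^{7} - 56871552\,\psi^{8} + 16213680\,\psi^{9} - 2696976\,\psi^{10} + 236520\,\psi^{11} - 7776\,\psi^{12})\\ &+ \sigma_5^2\,\alpha\,(-78989568 + 316283520\,\psi - 421440000\,\psi^{2} + 148286280\,\psi^{3} + 151481100\,\psi^{4} - 141331668\,\psi^{5} - 12989436\,\psi^{6} + 75338436\,\psi^{7} - 48491916\,\psi^{8} + 15619428\,\psi^{9} - 2725812\,\psi^{10} + 223236\,\psi^{11} - 3888\,\psi^{12})\\ &+ \sigma_5^2\,\alpha^2\,(-77070336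 + 198524928\,\psi - 187851264\,\psi^{2} + 44310000\,\psi^{3} + 55400808\,\psi^{4} - 47554008\,\psi^{5} + 8771448\,\psi^{6} + 5924856\,\psi^{7} - 3520104\,\psi^{8} + 414648\,\psi^{9} + 195048\,\psi^{10} - 73224\,\psi^{11} + 7776\,\psi^{12}).\end{aligned}$$ **Positivity.** Call the family positive if $\sigma_k>0$ for $k\in\{4,\dots,12,16,18,19,23,24,25,26\}$. If $-1\le\alpha<-\frac23$ and $\psi<\frac74$, positivity forces $0<\psi<\frac32$ and $1\le\sigma_4/\sigma_5<\frac{16}7$, with $\sigma_4/\sigma_5=1$ only for $\psi=1$. Conversely, for $\alpha=-1$, $\sigma_5>0$ and $0<\psi\le1.49$, the family is positive. -/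

import Mathlib

open MvPolynomial

noncomputable section

/-! ### Linear lattice Boltzmann schemes and their formal equivalent equations

Constant coefficient differential operators in `d` space variables are represented by elements of
`MvPolynomial (Fin d) ℝ`: the variable `X a` stands for the partial derivative in direction `a`. -/

/-- Data of a linear multiple relaxation time lattice Boltzmann scheme with `d` space dimensions,
`N` conserved moments and `p` nonconserved moments: the discrete velocities `v j`, the matrix `M`
of the moments (`m = M f`), the equilibrium matrix `E` (`Y^eq = E W`) and the relaxation
coefficients (`Y* = Y + s (Y^eq - Y)`). One time step of the scheme is
`f j (x, t + Δt) = f* j (x - v j Δt, t)` where `M f* = m*`. -/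
structure LBScheme (d N p : ℕ) where
  v : Fin (N + p) → Fin d → ℝ
  M : Matrix (Fin (N + p)) (Fin (N + p)) ℝ
  E : Matrix (Fin p) (Fin N) ℝ
  s : Fin p → ℝ

namespace LBScheme

variable {d N p : ℕ}

/-- The relaxation matrix `J₀`, `m* = J₀ m`, with blocks `[[I, 0], [S E, I - S]]`. -/
def relaxationMatrix (L : LBScheme d N p) : Matrix (Fin (N + p)) (Fin (N + p)) ℝ :=
  (Matrix.fromBlocks (1 : Matrix (Fin N) (Fin N) ℝ) 0
    (Matrix.diagonal L.s * L.E) (1 - Matrix.diagonal L.s)).submatrix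
      finSumFinEquiv.symm finSumFinEquiv.symm

/-- The operator `- ∑ a, (v j)_a ∂_a`. -/
def advection (L : LBScheme d N p) (j : Fin (N + p)) : MvPolynomial (Fin d) ℝ :=
  - ∑ a, C (L.v j a) * X a

/-- The derivation matrix of order `n`: the coefficient of `Δt ^ n` in the Taylor expansion of one
time step of the scheme, `m (t + Δt) = ∑ n, Δt ^ n (derivationMatrix n) m (t)`. -/
def derivationMatrix (L : LBScheme d N p) (n : ℕ) :
    Matrix (Fin (N + p)) (Fin (N + p)) (MvPolynomial (Fin d) ℝ) :=
  (1 / (n.factorial : ℝ)) •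
    (L.M.map C * Matrix.diagonal (fun j => L.advection j ^ n) * (L.M⁻¹).map C
      * L.relaxationMatrix.map C)

def blockA (L : LBScheme d N p) (n : ℕ) : Matrix (Fin N) (Fin N) (MvPolynomial (Fin d) ℝ) :=
  (L.derivationMatrix n).submatrix (Fin.castAdd p) (Fin.castAdd p)

def blockB (L : LBScheme d N p) (n : ℕ) : Matrix (Fin N) (Fin p) (MvPolynomial (Fin d) ℝ) :=
  (L.derivationMatrix n).submatrix (Fin.castAdd p) (Fin.natAdd N)

def blockC (L : LBScheme d N p) (n : ℕ) : Matrix (Fin p) (Fin N) (MvPolynomial (Fin d) ℝ) :=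
  (L.derivationMatrix n).submatrix (Fin.natAdd N) (Fin.castAdd p)

def blockD (L : LBScheme d N p) (n : ℕ) : Matrix (Fin p) (Fin p) (MvPolynomial (Fin d) ℝ) :=
  (L.derivationMatrix n).submatrix (Fin.natAdd N) (Fin.natAdd N)

/-- `gamma a j m` is the sum of the products `a l₁ * ⋯ * a l_j` over all `l₁ + ⋯ + l_j = m` with
`l_i ≥ 1`: if `∂_t = ∑_{l ≥ 1} Δt ^ (l - 1) a l`, then
`∂_t ^ j = ∑_m Δt ^ (m - j) gamma a j m`. -/
def gamma (a : ℕ → Matrix (Fin N) (Fin N) (MvPolynomial (Fin d) ℝ)) :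
    ℕ → ℕ → Matrix (Fin N) (Fin N) (MvPolynomial (Fin d) ℝ)
  | 0, m => if m = 0 then 1 else 0
  | j + 1, m => ∑ l ∈ Finset.range m, a (l + 1) * gamma a j (m - (l + 1))

/-- `kappa a b j m = ∑_{l ≤ m} b l * gamma a j (m - l)`: the coefficient of `Δt ^ (m - j)` in
`(∑_l Δt ^ l b l) (∑_{l ≥ 1} Δt ^ (l - 1) a l) ^ j`. -/
def kappa (a : ℕ → Matrix (Fin N) (Fin N) (MvPolynomial (Fin d) ℝ))
    (b : ℕ → Matrix (Fin p) (Fin N) (MvPolynomial (Fin d) ℝ))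
    (j m : ℕ) : Matrix (Fin p) (Fin N) (MvPolynomial (Fin d) ℝ) :=
  ∑ l ∈ Finset.range (m + 1), b l * gamma a j (m - l)

/-- The coefficients `α_1, …, α_k` and `β_0, …, β_k` of the formal expansions
`∂_t W = (∑_{l ≥ 1} Δt ^ (l - 1) α_l) W` and `Y = (∑_{l ≥ 0} Δt ^ l β_l) W`, computed by
identification of the powers of `Δt` in the Taylor expansion of the scheme (all the other entries
of the two sequences are zero). -/
def expansion (L : LBScheme d N p) : ℕ →
    (ℕ → Matrix (Fin N) (Fin N) (MvPolynomial (Fin d) ℝ)) ×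
      (ℕ → Matrix (Fin p) (Fin N) (MvPolynomial (Fin d) ℝ))
  | 0 => (fun _ => 0, Function.update (fun _ => 0) 0 (L.E.map C))
  | k + 1 =>
    let a := (expansion L k).1
    let b := (expansion L k).2
    let a₁ := Function.update a (k + 1)
      (L.blockA (k + 1) + ∑ j ∈ Finset.Icc 1 (k + 1), L.blockB j * b (k + 1 - j)
        - ∑ j ∈ Finset.Icc 2 (k + 1), (1 / (j.factorial : ℝ)) • gamma a j (k + 1))
    let b₁ := Function.update b (k + 1)
      (Matrix.diagonal (fun i => (C (L.s i)⁻¹ : MvPolynomial (Fin d) ℝ)) *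
        (L.blockC (k + 1) + ∑ j ∈ Finset.Icc 1 (k + 1), L.blockD j * b (k + 1 - j)
          - ∑ j ∈ Finset.Icc 1 (k + 1), (1 / (j.factorial : ℝ)) • kappa a₁ b j (k + 1)))
    (a₁, b₁)

/-- The space differential operator `α_l` of order `l` of the equivalent equations. -/
def alpha (L : LBScheme d N p) (l : ℕ) : Matrix (Fin N) (Fin N) (MvPolynomial (Fin d) ℝ) :=
  (L.expansion l).1 l

/-- The equivalent equations truncated at order `l` are `∂_t W = (L.equivalentOp Δt l) W`, with
`L.equivalentOp Δt l = ∑_{j = 1}^{l} Δt ^ (j - 1) α_j`. -/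
def equivalentOp (L : LBScheme d N p) (dt : ℝ) (l : ℕ) :
    Matrix (Fin N) (Fin N) (MvPolynomial (Fin d) ℝ) :=
  ∑ j ∈ Finset.Icc 1 l, dt ^ (j - 1) • L.alpha j

end LBScheme

/-- The parameter of Hénon of a relaxation coefficient. -/
def henon (s : ℝ) : ℝ := 1 / s - 1 / 2

/-! ### Rotationally invariant acoustic operators in three dimensions, `W = (ρ, J)` -/

/-- The Laplace operator. -/
def laplacian : MvPolynomial (Fin 3) ℝ := ∑ a, X a ^ 2

/-- The curl operator acting on vector fields. -/
def curlOp : Matrix (Fin 3) (Fin 3) (MvPolynomial (Fin 3) ℝ) :=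
  !![0, - X 2, X 1;
     X 2, 0, - X 0;
     - X 1, X 0, 0]

/-- The operator on `W = (ρ, J)` with the blocks `ρ → ρ`, `J → ρ`, `ρ → J` and `J → J`. -/
def acousticBlocks (a : MvPolynomial (Fin 3) ℝ) (b c : Fin 3 → MvPolynomial (Fin 3) ℝ)
    (D : Matrix (Fin 3) (Fin 3) (MvPolynomial (Fin 3) ℝ)) :
    Matrix (Fin 4) (Fin 4) (MvPolynomial (Fin 3) ℝ) :=
  Matrix.of (Fin.cons (Fin.cons a b) fun i => Fin.cons (c i) (D i))

/-- `∂_t W = P W` is a rotationally invariant system of acoustic type in dimension three: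
`∂_t ρ + ∑_k (a_k Δ^k ρ + b_k div Δ^k J) = 0` and
`∂_t J + ∑_k (d_k ∇ Δ^k ρ + m_k Δ^k J + e_k ∇ div Δ^k J + f_k curl Δ^k J) = 0`
with finite sums. -/
def IsIsotropicAcoustic (P : Matrix (Fin 4) (Fin 4) (MvPolynomial (Fin 3) ℝ)) : Prop :=
  ∃ (K : ℕ) (a b d m e f : ℕ → ℝ),
    P = - ∑ k ∈ Finset.range K, acousticBlocks
      (C (a k) * laplacian ^ k)
      (fun j => C (b k) * laplacian ^ k * X j)
      (fun i => C (d k) * laplacian ^ k * X i)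
      (Matrix.of fun i j =>
        (if i = j then C (m k) * laplacian ^ k else 0)
          + C (e k) * laplacian ^ k * (X i * X j)
          + C (f k) * laplacian ^ k * curlOp i j)

/-- `∂_t W = P W` is the system
`∂_t ρ + div J + ξ Δ div J + η Δ² ρ = 0`,
`∂_t J + c₀² ∇ρ - μ Δ J - ζ ∇ div J + χ ∇ Δ ρ + μ₄ Δ² J + ζ₄ ∇ div Δ J = 0`. -/
def acousticOp (c0sq mu zeta xi chi eta mu4 zeta4 : ℝ) :
    Matrix (Fin 4) (Fin 4) (MvPolynomial (Fin 3) ℝ) :=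
  - acousticBlocks
      (C eta * laplacian ^ 2)
      (fun j => X j + C xi * laplacian * X j)
      (fun i => C c0sq * X i + C chi * laplacian * X i)
      (Matrix.of fun i j =>
        (if i = j then - (C mu * laplacian) + C mu4 * laplacian ^ 2 else 0)
          - C zeta * (X i * X j) + C zeta4 * laplacian * (X i * X j))

/-! ### The D3Q27 scheme -/

/-- The velocities of D3Q27: all the vectors `λ (e₀, e₁, e₂)` with `e_a ∈ {-1, 0, 1}`. -/
def d3q27Velocity (lam : ℝ) (j : Fin 27) (a : Fin 3) : ℝ :=
  lam * (((j.val / 3 ^ a.val % 3 : ℕ) : ℝ) - 1)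

/-- The 27 polynomials (pairwise orthogonal on the set of velocities) that define the moments
`1; X, Y, Z; ε; XX, WW; XY, YZ, ZX; q; r; ε₂; ε₃; XXₑ, WWₑ; XYₑ, YZₑ, ZXₑ;`
three antisymmetric moments of order three; `XYZ`. -/
def d3q27Poly (lam : ℝ) (w : Fin 3 → ℝ) : Fin 27 → ℝ :=
  let x := w 0
  let y := w 1
  let z := w 2
  let n := x ^ 2 + y ^ 2 + z ^ 2
  ![1,
    x, y, z,
    n - 2 * lam ^ 2,
    2 * x ^ 2 - y ^ 2 - z ^ 2, y ^ 2 - z ^ 2,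
    x * y, y * z, z * x,
    x * (3 * n - 7 * lam ^ 2), y * (3 * n - 7 * lam ^ 2), z * (3 * n - 7 * lam ^ 2),
    x * (9 * n ^ 2 - 39 * lam ^ 2 * n + 38 * lam ^ 4) / 2,
    y * (9 * n ^ 2 - 39 * lam ^ 2 * n + 38 * lam ^ 4) / 2,
    z * (9 * n ^ 2 - 39 * lam ^ 2 * n + 38 * lam ^ 4) / 2,
    (3 * n ^ 2 - 11 * lam ^ 2 * n + 8 * lam ^ 4) / 2,
    (9 * n ^ 3 - 45 * lam ^ 2 * n ^ 2 + 60 * lam ^ 4 * n - 16 * lam ^ 6) / 2,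
    (2 * x ^ 2 - y ^ 2 - z ^ 2) * (3 * n - 5 * lam ^ 2), (y ^ 2 - z ^ 2) * (3 * n - 5 * lam ^ 2),
    x * y * (3 * n - 8 * lam ^ 2), y * z * (3 * n - 8 * lam ^ 2), z * x * (3 * n - 8 * lam ^ 2),
    x * (y ^ 2 - z ^ 2), y * (z ^ 2 - x ^ 2), z * (x ^ 2 - y ^ 2),
    x * y * z]

/-- The equilibrium of the moments 4 to 26 as functions of `W = (ρ, J)`:
`ε = α λ² ρ`, `q = - 2 λ² J`, `r = 2 λ⁴ J`, `ε₂ = - (2 + 3 α) λ⁴ ρ`, `ε₃ = γ λ⁶ ρ`, and zero for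
all the others. -/
def d3q27Equilibrium (lam alpha gam : ℝ) : Matrix (Fin 23) (Fin 4) ℝ :=
  Matrix.of ![
    ![alpha * lam ^ 2, 0, 0, 0],
    0, 0,
    0, 0, 0,
    ![0, -2 * lam ^ 2, 0, 0], ![0, 0, -2 * lam ^ 2, 0], ![0, 0, 0, -2 * lam ^ 2],
    ![0, 2 * lam ^ 4, 0, 0], ![0, 0, 2 * lam ^ 4, 0], ![0, 0, 0, 2 * lam ^ 4],
    ![-(2 + 3 * alpha) * lam ^ 4, 0, 0, 0],
    ![gam * lam ^ 6, 0, 0, 0],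
    0, 0,
    0, 0, 0,
    0, 0, 0,
    0]

/-- The D3Q27 scheme; `s k` is the relaxation coefficient of the moment number `k`, `4 ≤ k ≤ 26`
(the values `s 0, …, s 3` play no role). -/
def d3q27 (lam alpha gam : ℝ) (s : Fin 27 → ℝ) : LBScheme 3 4 23 where
  v := d3q27Velocity lam
  M := Matrix.of fun k j => d3q27Poly lam (d3q27Velocity lam j) k
  E := d3q27Equilibrium lam alpha gam
  s := fun l => s (Fin.natAdd 4 l)

/-! ### The one-parameter family of relaxation coefficients -/

/-- The cubic polynomial `14 + 23 ψ - 22 ψ² + 3 ψ³`. -/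
def cubicD (psi : ℝ) : ℝ := 3 * psi ^ 3 - 22 * psi ^ 2 + 23 * psi + 14

/-- The quadratic polynomial `3 ψ² - 11 ψ + 14` (it has no real root). -/
def quadD (psi : ℝ) : ℝ := 3 * psi ^ 2 - 11 * psi + 14

/-- The conditions on the parameters of Hénon `σ k` of the moments number `k`, for the ratio
`ψ = σ 18 / σ 5`. For `α = -1` the formula for `σ 16` becomes
`σ 5 (6 ψ⁵ - 35 ψ⁴ + 100 ψ³ - 267 ψ² + 506 ψ - 364) / ((4 ψ - 7) (3 ψ³ - 22 ψ² + 23 ψ + 14))`. -/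
structure IsFourthOrderFamily (alpha psi : ℝ) (σ : Fin 27 → ℝ) : Prop where
  h5 : σ 5 ≠ 0
  h6 : σ 6 = σ 5
  h7 : σ 7 = σ 5
  h8 : σ 8 = σ 5
  h9 : σ 9 = σ 5
  hpsi : psi = σ 18 / σ 5
  h19 : σ 19 = σ 18
  h4 : σ 4 = σ 5 * ((3 * psi ^ 3 - 4 * psi ^ 2 - 13 * psi + 32) / cubicD psi)
  h10 : σ 10 = 1 / (12 * σ 5) * ((3 * psi - 7) * (psi - 4) / quadD psi)
  h11 : σ 11 = σ 10
  h12 : σ 12 = σ 10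
  h16 : σ 16 = σ 5 *
    ((6 * psi ^ 5 - (36 * alpha + 71) * psi ^ 4 + (111 * alpha + 211) * psi ^ 3
        + (72 * alpha - 195) * psi ^ 2 - (657 * alpha + 151) * psi + (672 * alpha + 308))
      / (-(2 + 3 * alpha) * (4 * psi - 7) * cubicD psi))
  h23 : σ 23 = 1 / (12 * σ 5) * ((3 * psi ^ 2 - 7 * psi + 16) / quadD psi)
  h24 : σ 24 = σ 23
  h25 : σ 25 = σ 23
  h26 : σ 26 = 1 / (48 * σ 5) * ((21 * psi ^ 2 - 73 * psi + 100) / quadD psi)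

/-- All the parameters of Hénon fixed by the family are positive. -/
def FamilyPositive (σ : Fin 27 → ℝ) : Prop :=
  ∀ k ∈ ({4, 5, 6, 7, 8, 9, 10, 11, 12, 16, 18, 19, 23, 24, 25, 26} : Finset (Fin 27)), 0 < σ k

/-! ### The coefficients of the fourth order terms -/

/-- The coefficient `η`, with `S = σ 5` and `dx = Δx`. -/
def etaCoeff (lam dx alpha psi S : ℝ) : ℝ :=
  S * lam * dx ^ 3 / 108 *
    ((alpha + 2) * (32 * alpha - 8 - 13 * alpha * psi - 35 * psi - 4 * alpha * psi ^ 2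
      + 28 * psi ^ 2 + 3 * alpha * psi ^ 3 - 3 * psi ^ 3) / cubicD psi)

/-- The coefficient `μ₄`, with `S = σ 5` and `dx = Δx`. -/
def mu4Coeff (lam dx psi S : ℝ) : ℝ :=
  S * lam * dx ^ 3 / 108 *
    ((36 * psi ^ 2 * S ^ 2 - 132 * psi * S ^ 2 + 168 * S ^ 2 + 3 * psi ^ 2 - psi - 8) / quadD psi)

/-- The numerator of `ζ₄`, with `a = α`, `P = ψ` and `S = σ 5`. -/
def zeta4Num (a P S : ℝ) : ℝ :=
  (-526848 - 6082272 * P - 3413088 * P ^ 2 + 29925576 * P ^ 3 - 12827088 * P ^ 4 - 46884384 *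
      P ^ 5 + 76942908 * P ^ 6 - 56568924 * P ^ 7 + 24275088 * P ^ 8 - 6400920 * P ^ 9 +
      1015308 * P ^ 10 - 88452 * P ^ 11 + 3240 * P ^ 12)
    + a * (2458624 + 803992 * P - 16250948 * P ^ 2 + 15057742 * P ^ 3 + 22678777 * P ^ 4 -
      58798343 * P ^ 5 + 56334931 * P ^ 6 - 30298973 * P ^ 7 + 9787591 * P ^ 8 - 1834629 * P ^
      9 + 169965 * P ^ 10 - 3429 * P ^ 11 - 324 * P ^ 12)
    + a ^ 2 * (2458624 + 3742816 * P - 12657680 * P ^ 2 - 1230152 * P ^ 3 + 25708132 * P ^ 4 -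
      29063324 * P ^ 5 + 13802956 * P ^ 6 - 1316084 * P ^ 7 - 1805156 * P ^ 8 + 989292 * P ^ 9
      - 235980 * P ^ 10 + 27756 * P ^ 11 - 1296 * P ^ 12)
    + S ^ 2 * (-13105344 + 100016448 * P - 131926368 * P ^ 2 - 10762392 * P ^ 3 + 102921792 *
      P ^ 4 - 287184 * P ^ 5 - 117365232 * P ^ 6 + 116153808 * P ^ 7 - 56871552 * P ^ 8 +
      16213680 * P ^ 9 - 2696976 * P ^ 10 + 236520 * P ^ 11 - 7776 * P ^ 12)
    + S ^ 2 * a * (-78989568 + 316283520 * P - 421440000 * P ^ 2 + 148286280 * P ^ 3 +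
      151481100 * P ^ 4 - 141331668 * P ^ 5 - 12989436 * P ^ 6 + 75338436 * P ^ 7 - 48491916 *
      P ^ 8 + 15619428 * P ^ 9 - 2725812 * P ^ 10 + 223236 * P ^ 11 - 3888 * P ^ 12)
    + S ^ 2 * a ^ 2 * (-77070336 + 198524928 * P - 187851264 * P ^ 2 + 44310000 * P ^ 3 +
      55400808 * P ^ 4 - 47554008 * P ^ 5 + 8771448 * P ^ 6 + 5924856 * P ^ 7 - 3520104 * P ^
      8 + 414648 * P ^ 9 + 195048 * P ^ 10 - 73224 * P ^ 11 + 7776 * P ^ 12)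

/-- The coefficient `ζ₄`, with `S = σ 5` and `dx = Δx`. -/
def zeta4Coeff (lam dx alpha psi S : ℝ) : ℝ :=
  1 / 108 * (S * lam * dx ^ 3 / ((4 * psi - 7) * quadD psi * cubicD psi ^ 3))
    * zeta4Num alpha psi S

end

/-! Let `A` be the free streaming generator acting on moments, `A = M diag(-v · ∂) M⁻¹`. One step of
the scheme reads `exp(Δt ∂_t) m = exp(Δt A) m*`. Formally `∂_t` is right multiplication by `∑ Δt ^
(l - 1) α_l`, so it commutes with left multiplication by `A`. With the mean `μ = (m + m*) / 2`, the
jump `δ = m - m*` and `u = Δt (A - ∂_t)`, this becomes `(u / 2) coth(u / 2) δ = u μ`, that is `(1 +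
u² / 12 - ⋯) δ = u μ`. Since `δ` starts at order one, the term in `u²` suffices up to order four
(`defect_one`, …, `defect_four`).

The relaxation law says that `δ` vanishes on conserved moments and that, beyond order zero, `μ = σ
δ` on the others (`midpoint_succ_natAdd`). Thus only the parameters of Hénon occur, and the
conserved rows of each relation give `α_l` (`isD3Q27Expansion`).

For D3Q27 the generator is sparse and is certified without inverting `M`: every column of `M` is an
eigenvector of the explicit operator `d3q27Streaming` (`d3q27Streaming_poly`), which also gives the
invertibility of `M`. The orders one to three are then isotropic as soon as `σ 5 = ⋯ = σ 9` and `σ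
18 = σ 19`. At order four the mass row is isotropic as well, and matching monomials in the momentum
rows leaves the seven relations of `IsIsotropicFourthOrder`. They are rational identities in `ψ`,
`α`, `σ 5`, verified in `isIsotropicFourthOrder_family`.

Positivity rests on the signs of `cubicD` and of the numerator of `σ 16`, and on the identity `σ 4 /
σ 5 - 1 = 18 (ψ - 1)² / cubicD ψ`. -/

noncomputable section

/-! ### The formal expansion as an identity of Taylor coefficients. -/

namespace LBScheme

variable {d N p : ℕ}

/-- The coefficient `β_l` of the formal expansion `Y = (∑_{l ≥ 0} Δt ^ l β_l) W`. -/
def beta (L : LBScheme d N p) (l : ℕ) : Matrix (Fin p) (Fin N) (MvPolynomial (Fin d) ℝ) :=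
  (L.expansion l).2 l

theorem expansion_fst_apply (L : LBScheme d N p) {l k : ℕ} (h : l ≤ k) :
    (L.expansion k).1 l = L.alpha l := by
  induction k, h using Nat.le_induction with
  | base => rfl
  | succ k hk ih =>
    rw [expansion, ← ih]
    exact Function.update_of_ne (by omega) _ _

theorem expansion_snd_apply (L : LBScheme d N p) {l k : ℕ} (h : l ≤ k) :
    (L.expansion k).2 l = L.beta l := by
  induction k, h using Nat.le_induction with
  | base => rfl
  | succ k hk ih =>
    rw [expansion, ← ih]
    exact Function.update_of_ne (by omega) _ _

theorem gamma_succ_zero (a : ℕ → Matrix (Fin N) (Fin N) (MvPolynomial (Fin d) ℝ)) (j : ℕ) :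
    gamma a (j + 1) 0 = 0 := by
  simp [gamma]

theorem gamma_congr {a a' : ℕ → Matrix (Fin N) (Fin N) (MvPolynomial (Fin d) ℝ)} (j : ℕ) {m : ℕ}
    (h : ∀ l, 1 ≤ l → l ≤ m → a l = a' l) : gamma a j m = gamma a' j m := by
  induction j generalizing m with
  | zero => rfl
  | succ j ih =>
    refine Finset.sum_congr rfl fun l hl => ?_
    rw [Finset.mem_range] at hl
    rw [h (l + 1) (by omega) (by omega), ih fun i h1 h2 => h i h1 (by omega)]

/-- In a sum of at least two positive parts equal to `m`, every part is smaller than `m`. Hence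
`α_m` does not occur on the right-hand side of its own recursion. -/
theorem gamma_congr_of_lt {a a' : ℕ → Matrix (Fin N) (Fin N) (MvPolynomial (Fin d) ℝ)} (j : ℕ)
    {m : ℕ} (h : ∀ l, 1 ≤ l → l < m → a l = a' l) :
    gamma a (j + 2) m = gamma a' (j + 2) m := by
  refine Finset.sum_congr rfl fun l hl => ?_
  rw [Finset.mem_range] at hl
  rcases Nat.lt_or_ge (l + 1) m with h1 | h1
  · rw [h (l + 1) (by omega) h1, gamma_congr _ fun i h2 h3 => h i h2 (by omega)]
  · rw [Nat.sub_eq_zero_of_le h1, gamma_succ_zero, gamma_succ_zero, mul_zero, mul_zero]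

theorem alpha_succ (L : LBScheme d N p) (k : ℕ) :
    L.alpha (k + 1) = L.blockA (k + 1) + ∑ j ∈ Finset.Icc 1 (k + 1), L.blockB j * L.beta (k + 1 - j)
      - ∑ j ∈ Finset.Icc 2 (k + 1), (1 / (j.factorial : ℝ)) • gamma L.alpha j (k + 1) := by
  have h1 : ∑ j ∈ Finset.Icc 1 (k + 1), L.blockB j * (L.expansion k).2 (k + 1 - j) =
      ∑ j ∈ Finset.Icc 1 (k + 1), L.blockB j * L.beta (k + 1 - j) := by
    refine Finset.sum_congr rfl fun j hj => ?_
    rw [Finset.mem_Icc] at hj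
    rw [expansion_snd_apply L (by omega)]
  have h2 : ∑ j ∈ Finset.Icc 2 (k + 1),
        (1 / (j.factorial : ℝ)) • gamma (L.expansion k).1 j (k + 1) =
      ∑ j ∈ Finset.Icc 2 (k + 1), (1 / (j.factorial : ℝ)) • gamma L.alpha j (k + 1) := by
    refine Finset.sum_congr rfl fun j hj => ?_
    obtain ⟨i, rfl⟩ := Nat.exists_eq_add_of_le' (Finset.mem_Icc.1 hj).1
    rw [gamma_congr_of_lt i fun l _ h2 => expansion_fst_apply L (by omega)]
  rw [← h1, ← h2]
  exact Function.update_self _ _ _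

theorem beta_zero (L : LBScheme d N p) : L.beta 0 = L.E.map C := by
  simp [beta, expansion]

theorem beta_succ (L : LBScheme d N p) (k : ℕ) :
    L.beta (k + 1) = Matrix.diagonal (fun i => (C (L.s i)⁻¹ : MvPolynomial (Fin d) ℝ)) *
      (L.blockC (k + 1) + ∑ j ∈ Finset.Icc 1 (k + 1), L.blockD j * L.beta (k + 1 - j)
        - ∑ j ∈ Finset.Icc 1 (k + 1), (1 / (j.factorial : ℝ)) •
            kappa L.alpha L.beta j (k + 1)) := by
  have h1 : ∑ j ∈ Finset.Icc 1 (k + 1), L.blockD j * (L.expansion k).2 (k + 1 - j) =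
      ∑ j ∈ Finset.Icc 1 (k + 1), L.blockD j * L.beta (k + 1 - j) := by
    refine Finset.sum_congr rfl fun j hj => ?_
    rw [Finset.mem_Icc] at hj
    rw [expansion_snd_apply L (by omega)]
  have h2 : ∑ j ∈ Finset.Icc 1 (k + 1), (1 / (j.factorial : ℝ)) •
        kappa (L.expansion (k + 1)).1 (L.expansion k).2 j (k + 1) =
      ∑ j ∈ Finset.Icc 1 (k + 1), (1 / (j.factorial : ℝ)) • kappa L.alpha L.beta j (k + 1) := by
    refine Finset.sum_congr rfl fun j hj => ?_
    obtain ⟨i, rfl⟩ := Nat.exists_eq_add_of_le' (Finset.mem_Icc.1 hj).1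
    suffices h : kappa (L.expansion (k + 1)).1 (L.expansion k).2 (i + 1) (k + 1) =
        kappa L.alpha L.beta (i + 1) (k + 1) by rw [h]
    rw [kappa, kappa]
    refine Finset.sum_congr rfl fun l hl => ?_
    rw [Finset.mem_range] at hl
    rcases Nat.lt_or_ge l (k + 1) with h | h
    · rw [expansion_snd_apply L (by omega),
        gamma_congr (i + 1) fun l _ h3 => expansion_fst_apply L (by omega)]
    -- The term `l = k + 1` would involve `β_(k+1)` itself; it is multiplied by `gamma` at index
    -- zero, which vanishes for `i + 1 ≥ 1` factors.
    · rw [Nat.sub_eq_zero_of_le h, gamma_succ_zero, gamma_succ_zero, Matrix.mul_zero,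
        Matrix.mul_zero]
  rw [← h1, ← h2]
  exact Function.update_self _ _ _

/-- The generator `M diag(- v · ∂) M⁻¹` of the free streaming, acting on the moments. -/
def streamingMatrix (L : LBScheme d N p) :
    Matrix (Fin (N + p)) (Fin (N + p)) (MvPolynomial (Fin d) ℝ) :=
  L.M.map C * Matrix.diagonal L.advection * (L.M⁻¹).map C

/-- The relaxation matrix with entries seen as differential operators of order zero. -/
def relaxationOp (L : LBScheme d N p) :
    Matrix (Fin (N + p)) (Fin (N + p)) (MvPolynomial (Fin d) ℝ) :=
  L.relaxationMatrix.map C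

/-- Inner factors `M⁻¹ M` cancel in powers of the conjugated diagonal matrix, so the derivation
matrices are the Taylor coefficients of `exp(Δt A) J₀`. -/
theorem derivationMatrix_eq (L : LBScheme d N p) (hM : IsUnit L.M) (n : ℕ) :
    L.derivationMatrix n =
      (1 / (n.factorial : ℝ)) • (L.streamingMatrix ^ n * L.relaxationOp) := by
  have h1 : (L.M⁻¹).map (C : ℝ →+* MvPolynomial (Fin d) ℝ) * L.M.map C = 1 := by
    rw [← Matrix.map_mul, Matrix.nonsing_inv_mul _ ((Matrix.isUnit_iff_isUnit_det _).1 hM)]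
    exact Matrix.map_one _ (map_zero _) (map_one _)
  have h2 : L.M.map (C : ℝ →+* MvPolynomial (Fin d) ℝ) * (L.M⁻¹).map C = 1 := by
    rw [← Matrix.map_mul, Matrix.mul_nonsing_inv _ ((Matrix.isUnit_iff_isUnit_det _).1 hM)]
    exact Matrix.map_one _ (map_zero _) (map_one _)
  have h3 : L.M.map C * Matrix.diagonal (fun j => L.advection j ^ n) * (L.M⁻¹).map C
      = L.streamingMatrix ^ n := by
    induction n with
    | zero => simpa using h2
    | succ n ih =>
      rw [pow_succ, ← ih, streamingMatrix]
      have : (fun j => L.advection j ^ (n + 1)) = fun j => L.advection j ^ n * L.advection j := by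
        ext1 j; exact pow_succ _ _
      rw [this, ← Matrix.diagonal_mul_diagonal]
      simp only [Matrix.mul_assoc]
      rw [← Matrix.mul_assoc ((L.M⁻¹).map C) (L.M.map C), h1, Matrix.one_mul]
  rw [derivationMatrix, h3, relaxationOp]

/-- The coefficient of `Δt ^ l` in the expansion of all the moments in terms of `W`. -/
def moments (L : LBScheme d N p) (l : ℕ) :
    Matrix (Fin (N + p)) (Fin N) (MvPolynomial (Fin d) ℝ) :=
  Matrix.of fun i j => Fin.addCases (motive := fun _ => MvPolynomial (Fin d) ℝ)
    (fun i => (if l = 0 then 1 else 0 : Matrix (Fin N) (Fin N) (MvPolynomial (Fin d) ℝ)) i j)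
    (fun i => L.beta l i j) i

theorem moments_castAdd (L : LBScheme d N p) (l : ℕ) (i j : Fin N) :
    L.moments l (Fin.castAdd p i) j =
      (if l = 0 then 1 else 0 : Matrix (Fin N) (Fin N) (MvPolynomial (Fin d) ℝ)) i j := by
  simp [moments]

theorem moments_natAdd (L : LBScheme d N p) (l : ℕ) (i : Fin p) (j : Fin N) :
    L.moments l (Fin.natAdd N i) j = L.beta l i j := by
  simp [moments]

theorem relaxationMatrix_mul_castAdd (L : LBScheme d N p)
    (G : Matrix (Fin (N + p)) (Fin N) (MvPolynomial (Fin d) ℝ)) (i : Fin N) (j : Fin N) :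
    (L.relaxationOp * G) (Fin.castAdd p i) j = G (Fin.castAdd p i) j := by
  rw [Matrix.mul_apply, Fin.sum_univ_add]
  simp [relaxationOp, relaxationMatrix, Matrix.one_apply]

theorem relaxationMatrix_mul_natAdd (L : LBScheme d N p)
    (G : Matrix (Fin (N + p)) (Fin N) (MvPolynomial (Fin d) ℝ)) (i : Fin p) (j : Fin N) :
    (L.relaxationOp * G) (Fin.natAdd N i) j =
      C (L.s i) * (∑ k, C (L.E i k) * G (Fin.castAdd p k) j)
        + (1 - C (L.s i)) * G (Fin.natAdd N i) j := by
  rw [Matrix.mul_apply, Fin.sum_univ_add]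
  simp [relaxationOp, relaxationMatrix, Matrix.one_apply, Matrix.sub_apply, Matrix.diagonal_apply,
    Finset.mul_sum, mul_assoc, Matrix.diagonal_mul]
  rw [Finset.sum_eq_single i]
  · simp
  · intro b _ hb
    simp [hb.symm]
  · simp

theorem gamma_zero_left (a : ℕ → Matrix (Fin N) (Fin N) (MvPolynomial (Fin d) ℝ)) (m : ℕ) :
    gamma a 0 m = if m = 0 then 1 else 0 := rfl

theorem gamma_one (a : ℕ → Matrix (Fin N) (Fin N) (MvPolynomial (Fin d) ℝ)) (m : ℕ) :
    gamma a 1 (m + 1) = a (m + 1) := by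
  rw [gamma, Finset.sum_eq_single m]
  · simp [gamma]
  · intro l hl hlm
    rw [Finset.mem_range] at hl
    rw [gamma_zero_left, if_neg (by omega), mul_zero]
  · simp

theorem mul_moments_castAdd (L : LBScheme d N p)
    (D : Matrix (Fin (N + p)) (Fin (N + p)) (MvPolynomial (Fin d) ℝ)) (l : ℕ) (i j : Fin N) :
    (D * L.moments l) (Fin.castAdd p i) j =
      (if l = 0 then D (Fin.castAdd p i) (Fin.castAdd p j) else 0)
        + (D.submatrix (Fin.castAdd p) (Fin.natAdd N) * L.beta l) i j := by
  rw [Matrix.mul_apply, Fin.sum_univ_add]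
  simp only [moments_castAdd, moments_natAdd]
  congr 1
  split_ifs <;> simp [Matrix.one_apply]

theorem mul_moments_natAdd (L : LBScheme d N p)
    (D : Matrix (Fin (N + p)) (Fin (N + p)) (MvPolynomial (Fin d) ℝ)) (l : ℕ) (i : Fin p)
    (j : Fin N) :
    (D * L.moments l) (Fin.natAdd N i) j =
      (if l = 0 then D (Fin.natAdd N i) (Fin.castAdd p j) else 0)
        + (D.submatrix (Fin.natAdd N) (Fin.natAdd N) * L.beta l) i j := by
  rw [Matrix.mul_apply, Fin.sum_univ_add]
  simp only [moments_castAdd, moments_natAdd]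
  congr 1
  split_ifs <;> simp [Matrix.one_apply]

theorem moments_mul_castAdd (L : LBScheme d N p)
    (X : Matrix (Fin N) (Fin N) (MvPolynomial (Fin d) ℝ)) (l : ℕ) (i j : Fin N) :
    (L.moments l * X) (Fin.castAdd p i) j = if l = 0 then X i j else 0 := by
  rw [Matrix.mul_apply]
  simp only [moments_castAdd]
  split_ifs <;> simp [Matrix.one_apply]

theorem moments_mul_natAdd (L : LBScheme d N p)
    (X : Matrix (Fin N) (Fin N) (MvPolynomial (Fin d) ℝ)) (l : ℕ) (i : Fin p) (j : Fin N) :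
    (L.moments l * X) (Fin.natAdd N i) j = (L.beta l * X) i j := by
  simp only [Matrix.mul_apply, moments_natAdd]

theorem sum_range_eq_add_sum_Icc {A : Type*} [AddCommMonoid A] (f : ℕ → A) (k : ℕ) :
    ∑ j ∈ Finset.range (k + 2), f j = f 0 + ∑ j ∈ Finset.Icc 1 (k + 1), f j := by
  rw [Finset.range_eq_Ico, Finset.sum_eq_sum_Ico_succ_bot (by omega)]
  rfl

theorem sum_Icc_one_eq_add_sum_Icc {A : Type*} [AddCommMonoid A] (f : ℕ → A) (k : ℕ) :
    ∑ j ∈ Finset.Icc 1 (k + 1), f j = f 1 + ∑ j ∈ Finset.Icc 2 (k + 1), f j := by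
  change ∑ j ∈ Finset.Ico 1 (k + 2), f j = _
  rw [Finset.sum_eq_sum_Ico_succ_bot (by omega)]
  rfl

theorem derivationMatrix_zero (L : LBScheme d N p) (hM : IsUnit L.M) :
    L.derivationMatrix 0 = L.relaxationOp := by
  simp [derivationMatrix_eq L hM]

/-- Identification of the coefficients of `Δt ^ (k + 1)` in the Taylor expansion of the scheme. -/
theorem moments_taylor (L : LBScheme d N p) (hM : IsUnit L.M) (hs : ∀ i, L.s i ≠ 0) (k : ℕ) :
    ∑ j ∈ Finset.range (k + 2), L.derivationMatrix j * L.moments (k + 1 - j) =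
      ∑ j ∈ Finset.range (k + 2), (1 / (j.factorial : ℝ)) •
        ∑ l ∈ Finset.range (k + 2), L.moments l * gamma L.alpha j (k + 1 - l) := by
  have h0 : ∑ l ∈ Finset.range (k + 2), L.moments l * gamma L.alpha 0 (k + 1 - l) =
      L.moments (k + 1) := by
    rw [Finset.sum_eq_single (k + 1)]
    · simp [gamma]
    · intro l hl hlk
      rw [Finset.mem_range] at hl
      rw [gamma_zero_left, if_neg (by omega), Matrix.mul_zero]
    · simp
  rw [sum_range_eq_add_sum_Icc, sum_range_eq_add_sum_Icc, h0, derivationMatrix_zero L hM]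
  ext1 i j
  refine Fin.addCases (fun i => ?_) (fun i => ?_) i
  · have h1 : ∀ n ∈ Finset.Icc 1 (k + 1),
        (L.derivationMatrix n * L.moments (k + 1 - n)) (Fin.castAdd p i) j =
          (if n = k + 1 then L.blockA (k + 1) i j else 0)
            + (L.blockB n * L.beta (k + 1 - n)) i j := by
      intro n hn
      rw [Finset.mem_Icc] at hn
      rw [mul_moments_castAdd]
      congr 1
      by_cases h : n = k + 1
      · subst h; simp [blockA]
      · rw [if_neg h, if_neg (by omega)]
    have h2 : ∀ n, (∑ l ∈ Finset.range (k + 2), L.moments l * gamma L.alpha n (k + 1 - l))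
        (Fin.castAdd p i) j = gamma L.alpha n (k + 1) i j := by
      intro n
      simp only [Matrix.sum_apply, moments_mul_castAdd]
      simp
    have h3 := congrFun (congrFun (L.alpha_succ k) i) j
    simp only [Matrix.add_apply, Matrix.sum_apply, Matrix.smul_apply, Matrix.sub_apply] at h3
    simp only [Matrix.add_apply, Matrix.sum_apply, Matrix.smul_apply] at h2 ⊢
    rw [Finset.sum_congr rfl h1, relaxationMatrix_mul_castAdd, moments_castAdd,
      Finset.sum_add_distrib]
    simp only [h2]
    rw [sum_Icc_one_eq_add_sum_Icc (fun n => (1 / (n.factorial : ℝ)) • gamma L.alpha n (k + 1) i j),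
      gamma_one, h3]
    simp [moments_castAdd]
  · have h1 : ∀ n ∈ Finset.Icc 1 (k + 1),
        (L.derivationMatrix n * L.moments (k + 1 - n)) (Fin.natAdd N i) j =
          (if n = k + 1 then L.blockC (k + 1) i j else 0)
            + (L.blockD n * L.beta (k + 1 - n)) i j := by
      intro n hn
      rw [Finset.mem_Icc] at hn
      rw [mul_moments_natAdd]
      congr 1
      by_cases h : n = k + 1
      · subst h; simp [blockC]
      · rw [if_neg h, if_neg (by omega)]
    have h2 : ∀ n, (∑ l ∈ Finset.range (k + 2), L.moments l * gamma L.alpha n (k + 1 - l))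
        (Fin.natAdd N i) j = kappa L.alpha L.beta n (k + 1) i j := by
      intro n
      simp only [Matrix.sum_apply, moments_mul_natAdd, kappa]
    have h3 := congrFun (congrFun (L.beta_succ k) i) j
    rw [Matrix.diagonal_mul] at h3
    have h4 : C (L.s i) * L.beta (k + 1) i j =
        (L.blockC (k + 1) + ∑ j ∈ Finset.Icc 1 (k + 1), L.blockD j * L.beta (k + 1 - j)
        - ∑ j ∈ Finset.Icc 1 (k + 1), (1 / (j.factorial : ℝ)) •
            kappa L.alpha L.beta j (k + 1)) i j := by
      -- The recursion for `β` divides by `s i`; multiplying back restores the relaxation step,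
      -- which is where `s i ≠ 0` matters.
      rw [h3, ← mul_assoc, ← C_mul, mul_inv_cancel₀ (hs i), C_1, one_mul]
    simp only [Matrix.add_apply, Matrix.sum_apply, Matrix.smul_apply, Matrix.sub_apply] at h4
    simp only [Matrix.add_apply, Matrix.sum_apply, Matrix.smul_apply] at h2 ⊢
    rw [Finset.sum_congr rfl h1, relaxationMatrix_mul_natAdd, moments_natAdd,
      Finset.sum_add_distrib]
    simp only [h2, moments_castAdd]
    simp [moments_natAdd]
    simp at h4
    linear_combination -h4

/-! ### Mean and jump of the relaxation step, and the parameters of Hénon. -/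

/-- The coefficient of order `l` of the jump `m - m*` of the moments in one relaxation step. -/
def defect (L : LBScheme d N p) (l : ℕ) : Matrix (Fin (N + p)) (Fin N) (MvPolynomial (Fin d) ℝ) :=
  L.moments l - L.relaxationOp * L.moments l

/-- The coefficient of order `l` of the mean `(m + m*) / 2`. -/
def midpoint (L : LBScheme d N p) (l : ℕ) :
    Matrix (Fin (N + p)) (Fin N) (MvPolynomial (Fin d) ℝ) :=
  L.moments l - (1 / 2 : ℝ) • L.defect l

theorem moments_eq (L : LBScheme d N p) (l : ℕ) :
    L.moments l = L.midpoint l + (1 / 2 : ℝ) • L.defect l := by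
  rw [midpoint]; abel

theorem relaxationOp_mul_moments (L : LBScheme d N p) (l : ℕ) :
    L.relaxationOp * L.moments l = L.midpoint l - (1 / 2 : ℝ) • L.defect l := by
  rw [midpoint, defect]; module

theorem defect_castAdd (L : LBScheme d N p) (l : ℕ) (i j : Fin N) :
    L.defect l (Fin.castAdd p i) j = 0 := by
  rw [defect, Matrix.sub_apply, relaxationMatrix_mul_castAdd, sub_self]

theorem defect_zero (L : LBScheme d N p) : L.defect 0 = 0 := by
  ext1 i j
  refine Fin.addCases (fun i => ?_) (fun i => ?_) i
  · rw [defect_castAdd, Matrix.zero_apply]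
  · rw [defect, Matrix.sub_apply, relaxationMatrix_mul_natAdd]
    simp [moments_natAdd, moments_castAdd, beta_zero, Matrix.one_apply]
    ring

theorem midpoint_zero (L : LBScheme d N p) : L.midpoint 0 = L.moments 0 := by
  rw [midpoint, defect_zero]; simp

theorem midpoint_succ_castAdd (L : LBScheme d N p) (l : ℕ) (i j : Fin N) :
    L.midpoint (l + 1) (Fin.castAdd p i) j = 0 := by
  rw [midpoint, Matrix.sub_apply, Matrix.smul_apply, defect_castAdd, moments_castAdd]
  simp

/-- The jump is `s (Y - Y^eq)`, and the equilibrium has no term of positive order because `W` has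
none. So `Y` equals the jump divided by `s` there, and removing half the jump leaves the factor `1 /
s - 1 / 2`. -/
theorem midpoint_succ_natAdd (L : LBScheme d N p) (hs : ∀ i, L.s i ≠ 0) (l : ℕ) (i : Fin p)
    (j : Fin N) :
    L.midpoint (l + 1) (Fin.natAdd N i) j =
      C (henon (L.s i)) * L.defect (l + 1) (Fin.natAdd N i) j := by
  have h1 : L.defect (l + 1) (Fin.natAdd N i) j =
      C (L.s i) * L.moments (l + 1) (Fin.natAdd N i) j := by
    rw [defect, Matrix.sub_apply, relaxationMatrix_mul_natAdd]
    simp [moments_castAdd]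
    ring
  have h2 : (C (L.s i)⁻¹ * C (L.s i) : MvPolynomial (Fin d) ℝ) = 1 := by
    rw [← C_mul, inv_mul_cancel₀ (hs i), C_1]
  have h3 : (C (henon (L.s i)) : MvPolynomial (Fin d) ℝ) = C (L.s i)⁻¹ - C (1 / 2) := by
    rw [henon, one_div, C_sub]
  rw [midpoint, Matrix.sub_apply, Matrix.smul_apply, h1, h3, smul_eq_C_mul]
  linear_combination -L.moments (l + 1) (Fin.natAdd N i) j * h2

theorem gamma_two_two (a : ℕ → Matrix (Fin N) (Fin N) (MvPolynomial (Fin d) ℝ)) :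
    gamma a 2 2 = a 1 * a 1 := by
  simp [gamma, Finset.sum_range_succ]

theorem gamma_two_three (a : ℕ → Matrix (Fin N) (Fin N) (MvPolynomial (Fin d) ℝ)) :
    gamma a 2 3 = a 1 * a 2 + a 2 * a 1 := by
  simp [gamma, Finset.sum_range_succ]

theorem gamma_two_four (a : ℕ → Matrix (Fin N) (Fin N) (MvPolynomial (Fin d) ℝ)) :
    gamma a 2 4 = a 1 * a 3 + a 2 * a 2 + a 3 * a 1 := by
  simp [gamma, Finset.sum_range_succ]

theorem gamma_three_three (a : ℕ → Matrix (Fin N) (Fin N) (MvPolynomial (Fin d) ℝ)) :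
    gamma a 3 3 = a 1 * (a 1 * a 1) := by
  simp [gamma, Finset.sum_range_succ]

theorem gamma_three_four (a : ℕ → Matrix (Fin N) (Fin N) (MvPolynomial (Fin d) ℝ)) :
    gamma a 3 4 = a 1 * (a 1 * a 2 + a 2 * a 1) + a 2 * (a 1 * a 1) := by
  simp [gamma, Finset.sum_range_succ]

theorem gamma_four_four (a : ℕ → Matrix (Fin N) (Fin N) (MvPolynomial (Fin d) ℝ)) :
    gamma a 4 4 = a 1 * (a 1 * (a 1 * a 1)) := by
  simp [gamma, Finset.sum_range_succ]

theorem gamma_eq_zero_of_lt (a : ℕ → Matrix (Fin N) (Fin N) (MvPolynomial (Fin d) ℝ)) {j m : ℕ}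
    (h : m < j) : gamma a j m = 0 := by
  induction j generalizing m with
  | zero => omega
  | succ j ih =>
    refine Finset.sum_eq_zero fun l hl => ?_
    rw [Finset.mem_range] at hl
    rw [ih (by omega), mul_zero]

theorem derivationMatrix_mul_moments (L : LBScheme d N p) (hM : IsUnit L.M) (n l : ℕ) :
    L.derivationMatrix n * L.moments l =
      (1 / (n.factorial : ℝ)) • (L.streamingMatrix ^ n *
        (L.midpoint l - (1 / 2 : ℝ) • L.defect l)) := by
  rw [derivationMatrix_eq L hM, Matrix.smul_mul, Matrix.mul_assoc, relaxationOp_mul_moments]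

theorem midpoint_taylor (L : LBScheme d N p) (hM : IsUnit L.M) (hs : ∀ i, L.s i ≠ 0) (k : ℕ) :
    ∑ j ∈ Finset.range (k + 2), (1 / (j.factorial : ℝ)) • (L.streamingMatrix ^ j *
        (L.midpoint (k + 1 - j) - (1 / 2 : ℝ) • L.defect (k + 1 - j))) =
      ∑ j ∈ Finset.range (k + 2), (1 / (j.factorial : ℝ)) •
        ∑ l ∈ Finset.range (k + 2), (L.midpoint l + (1 / 2 : ℝ) • L.defect l) *
          gamma L.alpha j (k + 1 - l) := by
  simpa only [derivationMatrix_mul_moments L hM, ← moments_eq] using L.moments_taylor hM hs k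

theorem defect_one (L : LBScheme d N p) (hM : IsUnit L.M) (hs : ∀ i, L.s i ≠ 0) :
    L.defect 1 = L.streamingMatrix * L.midpoint 0 - L.midpoint 0 * L.alpha 1 := by
  have h := L.midpoint_taylor hM hs 0
  simp [Finset.sum_range_succ, Nat.factorial, defect_zero, gamma_zero_left, gamma_one,
    gamma_eq_zero_of_lt] at h
  linear_combination (norm := module) (-1 : ℝ) • h

theorem defect_two (L : LBScheme d N p) (hM : IsUnit L.M) (hs : ∀ i, L.s i ≠ 0) :
    L.defect 2 = L.streamingMatrix * L.midpoint 1 - L.midpoint 1 * L.alpha 1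
      - L.midpoint 0 * L.alpha 2 := by
  have h := L.midpoint_taylor hM hs 1
  have h1 := L.defect_one hM hs
  simp [Finset.sum_range_succ, Nat.factorial, defect_zero, gamma_zero_left, gamma_one,
    gamma_eq_zero_of_lt, gamma_two_two] at h
  rw [h1] at h
  simp only [pow_succ, pow_zero, one_mul, Matrix.add_mul, Matrix.mul_sub, Matrix.sub_mul,
    Matrix.smul_mul, Matrix.mul_smul, Matrix.mul_assoc] at h
  linear_combination (norm := module) (-1 : ℝ) • h

/-- The factor `1 / 12` is the first correction in `(u / 2) coth(u / 2)`; the bracket is `(A -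
∂_t)²` applied to the jump, with `∂_t` acting on the right. -/
theorem defect_three (L : LBScheme d N p) (hM : IsUnit L.M) (hs : ∀ i, L.s i ≠ 0) :
    L.defect 3 = L.streamingMatrix * L.midpoint 2 - L.midpoint 2 * L.alpha 1
      - L.midpoint 1 * L.alpha 2 - L.midpoint 0 * L.alpha 3
      - (1 / 12 : ℝ) • (L.streamingMatrix * (L.streamingMatrix * L.defect 1)
        - (2 : ℝ) • (L.streamingMatrix * (L.defect 1 * L.alpha 1))
        + L.defect 1 * (L.alpha 1 * L.alpha 1)) := by
  have h := L.midpoint_taylor hM hs 2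
  have h1 := L.defect_one hM hs
  have h2 := L.defect_two hM hs
  simp [Finset.sum_range_succ, Nat.factorial, defect_zero, gamma_zero_left, gamma_one,
    gamma_eq_zero_of_lt, gamma_two_two, gamma_two_three, gamma_three_three] at h
  rw [h2] at h
  rw [h1] at h ⊢
  simp only [pow_succ, pow_zero, one_mul, Matrix.mul_add, Matrix.add_mul, Matrix.mul_sub,
    Matrix.sub_mul, Matrix.smul_mul, Matrix.mul_smul, Matrix.mul_assoc] at h ⊢
  linear_combination (norm := module) (-1 : ℝ) • h

theorem defect_four (L : LBScheme d N p) (hM : IsUnit L.M) (hs : ∀ i, L.s i ≠ 0) :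
    L.defect 4 = L.streamingMatrix * L.midpoint 3 - L.midpoint 3 * L.alpha 1
      - L.midpoint 2 * L.alpha 2 - L.midpoint 1 * L.alpha 3 - L.midpoint 0 * L.alpha 4
      - (1 / 12 : ℝ) • (L.streamingMatrix * (L.streamingMatrix * L.defect 2)
        - (2 : ℝ) • (L.streamingMatrix * (L.defect 2 * L.alpha 1))
        + L.defect 2 * (L.alpha 1 * L.alpha 1)
        - (2 : ℝ) • (L.streamingMatrix * (L.defect 1 * L.alpha 2))
        + L.defect 1 * (L.alpha 1 * L.alpha 2 + L.alpha 2 * L.alpha 1)) := by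
  have h := L.midpoint_taylor hM hs 3
  have h1 := L.defect_one hM hs
  have h2 := L.defect_two hM hs
  have h3 := L.defect_three hM hs
  simp [Finset.sum_range_succ, Nat.factorial, defect_zero, gamma_zero_left, gamma_one,
    gamma_eq_zero_of_lt, gamma_two_two, gamma_two_three, gamma_three_three, gamma_two_four,
    gamma_three_four, gamma_four_four] at h
  rw [h3] at h
  rw [h2] at h ⊢
  rw [h1] at h ⊢
  simp only [pow_succ, pow_zero, one_mul, Matrix.mul_add, Matrix.add_mul, Matrix.mul_sub,
    Matrix.sub_mul, Matrix.smul_mul, Matrix.mul_smul, Matrix.mul_assoc] at h ⊢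
  linear_combination (norm := module) (-1 : ℝ) • h

end LBScheme

/-! ### The streaming operator of D3Q27 and the invertibility of the moment matrix. -/

/-- The operator `m ↦ M diag(- v · x) M⁻¹ m` of the D3Q27 scheme, in terms of the moments. -/
def d3q27Streaming (lam : ℝ) (x : Fin 3 → ℝ) (m : Fin 27 → ℝ) : Fin 27 → ℝ
  | 0 => -(x 0 * m 1 + x 1 * m 2 + x 2 * m 3)
  | 1 => -(x 0 * (2 / 3 * lam ^ 2 * m 0 + 1 / 3 * m 4 + 1 / 3 * m 5) + x 1 * m 7 + x 2 * m 9)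
  | 2 => -(x 0 * m 7 + x 1 * (2 / 3 * lam ^ 2 * m 0 + 1 / 3 * m 4 - 1 / 6 * m 5 + 1 / 2 * m 6)
      + x 2 * m 8)
  | 3 => -(x 0 * m 9 + x 1 * m 8
      + x 2 * (2 / 3 * lam ^ 2 * m 0 + 1 / 3 * m 4 - 1 / 6 * m 5 - 1 / 2 * m 6))
  | 4 => -(x 0 * (1 / 3 * lam ^ 2 * m 1 + 1 / 3 * m 10)
      + x 1 * (1 / 3 * lam ^ 2 * m 2 + 1 / 3 * m 11)
      + x 2 * (1 / 3 * lam ^ 2 * m 3 + 1 / 3 * m 12))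
  | 5 => -(x 0 * (2 / 3 * lam ^ 2 * m 1 - 1 / 3 * m 10)
      + x 1 * (-1 / 3 * lam ^ 2 * m 2 + 1 / 6 * m 11 - 3 / 2 * m 24)
      + x 2 * (-1 / 3 * lam ^ 2 * m 3 + 1 / 6 * m 12 + 3 / 2 * m 25))
  | 6 => -(x 0 * m 23 + x 1 * (1 / 3 * lam ^ 2 * m 2 - 1 / 6 * m 11 - 1 / 2 * m 24)
      + x 2 * (-1 / 3 * lam ^ 2 * m 3 + 1 / 6 * m 12 - 1 / 2 * m 25))
  | 7 => -(x 0 * (2 / 3 * lam ^ 2 * m 2 + 1 / 6 * m 11 - 1 / 2 * m 24)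
      + x 1 * (2 / 3 * lam ^ 2 * m 1 + 1 / 6 * m 10 + 1 / 2 * m 23) + x 2 * m 26)
  | 8 => -(x 0 * m 26 + x 1 * (2 / 3 * lam ^ 2 * m 3 + 1 / 6 * m 12 - 1 / 2 * m 25)
      + x 2 * (2 / 3 * lam ^ 2 * m 2 + 1 / 6 * m 11 + 1 / 2 * m 24))
  | 9 => -(x 0 * (2 / 3 * lam ^ 2 * m 3 + 1 / 6 * m 12 + 1 / 2 * m 25) + x 1 * m 26
      + x 2 * (2 / 3 * lam ^ 2 * m 1 + 1 / 6 * m 10 - 1 / 2 * m 23))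
  | 10 => -(x 0 * (4 / 3 * lam ^ 2 * m 4 - 2 / 3 * lam ^ 2 * m 5 + 2 / 3 * m 16 + 1 / 3 * m 18)
      + x 1 * (lam ^ 2 * m 7 + m 20) + x 2 * (lam ^ 2 * m 9 + m 22))
  | 11 => -(x 0 * (lam ^ 2 * m 7 + m 20)
      + x 1 * (4 / 3 * lam ^ 2 * m 4 + 1 / 3 * lam ^ 2 * m 5 - lam ^ 2 * m 6
      + 2 / 3 * m 16 - 1 / 6 * m 18 + 1 / 2 * m 19) + x 2 * (lam ^ 2 * m 8 + m 21))
  | 12 => -(x 0 * (lam ^ 2 * m 9 + m 22) + x 1 * (lam ^ 2 * m 8 + m 21)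
      + x 2 * (4 / 3 * lam ^ 2 * m 4 + 1 / 3 * lam ^ 2 * m 5 + lam ^ 2 * m 6
      + 2 / 3 * m 16 - 1 / 6 * m 18 - 1 / 2 * m 19))
  | 13 => -(x 0 * (2 / 3 * lam ^ 2 * m 16 + 1 / 3 * m 17 - 2 / 3 * lam ^ 2 * m 18)
      + x 1 * lam ^ 2 * m 20 + x 2 * lam ^ 2 * m 22)
  | 14 => -(x 0 * lam ^ 2 * m 20
      + x 1 * (2 / 3 * lam ^ 2 * m 16 + 1 / 3 * m 17 + 1 / 3 * lam ^ 2 * m 18 - lam ^ 2 * m 19)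
      + x 2 * lam ^ 2 * m 21)
  | 15 => -(x 0 * lam ^ 2 * m 22 + x 1 * lam ^ 2 * m 21
      + x 2 * (2 / 3 * lam ^ 2 * m 16 + 1 / 3 * m 17 + 1 / 3 * lam ^ 2 * m 18 + lam ^ 2 * m 19))
  | 16 => -(x 0 * (1 / 3 * lam ^ 2 * m 10 + 1 / 3 * m 13)
      + x 1 * (1 / 3 * lam ^ 2 * m 11 + 1 / 3 * m 14)
      + x 2 * (1 / 3 * lam ^ 2 * m 12 + 1 / 3 * m 15))
  | 17 => -(x 0 * lam ^ 2 * m 13 + x 1 * lam ^ 2 * m 14 + x 2 * lam ^ 2 * m 15)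
  | 18 => -(x 0 * (1 / 3 * lam ^ 2 * m 10 - 2 / 3 * m 13)
      + x 1 * (-1 / 6 * lam ^ 2 * m 11 + 1 / 3 * m 14 - 3 / 2 * lam ^ 2 * m 24)
      + x 2 * (-1 / 6 * lam ^ 2 * m 12 + 1 / 3 * m 15 + 3 / 2 * lam ^ 2 * m 25))
  | 19 => -(x 0 * lam ^ 2 * m 23
      + x 1 * (1 / 6 * lam ^ 2 * m 11 - 1 / 3 * m 14 - 1 / 2 * lam ^ 2 * m 24)
      + x 2 * (-1 / 6 * lam ^ 2 * m 12 + 1 / 3 * m 15 - 1 / 2 * lam ^ 2 * m 25))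
  | 20 => -(x 0 * (1 / 3 * lam ^ 2 * m 11 + 1 / 3 * m 14 + lam ^ 2 * m 24)
      + x 1 * (1 / 3 * lam ^ 2 * m 10 + 1 / 3 * m 13 - lam ^ 2 * m 23) + x 2 * lam ^ 2 * m 26)
  | 21 => -(x 0 * lam ^ 2 * m 26 + x 1 * (1 / 3 * lam ^ 2 * m 12 + 1 / 3 * m 15 + lam ^ 2 * m 25)
      + x 2 * (1 / 3 * lam ^ 2 * m 11 + 1 / 3 * m 14 - lam ^ 2 * m 24))
  | 22 => -(x 0 * (1 / 3 * lam ^ 2 * m 12 + 1 / 3 * m 15 - lam ^ 2 * m 25) + x 1 * lam ^ 2 * m 26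
      + x 2 * (1 / 3 * lam ^ 2 * m 10 + 1 / 3 * m 13 + lam ^ 2 * m 23))
  | 23 => -(x 0 * (2 / 3 * lam ^ 2 * m 6 + 1 / 3 * m 19)
      + x 1 * (1 / 3 * lam ^ 2 * m 7 - 1 / 3 * m 20)
      + x 2 * (-1 / 3 * lam ^ 2 * m 9 + 1 / 3 * m 22))
  | 24 => -(x 0 * (-1 / 3 * lam ^ 2 * m 7 + 1 / 3 * m 20)
      + x 1 * (-1 / 3 * lam ^ 2 * m 5 - 1 / 3 * lam ^ 2 * m 6 - 1 / 6 * m 18 - 1 / 6 * m 19)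
      + x 2 * (1 / 3 * lam ^ 2 * m 8 - 1 / 3 * m 21))
  | 25 => -(x 0 * (1 / 3 * lam ^ 2 * m 9 - 1 / 3 * m 22)
      + x 1 * (-1 / 3 * lam ^ 2 * m 8 + 1 / 3 * m 21)
      + x 2 * (1 / 3 * lam ^ 2 * m 5 - 1 / 3 * lam ^ 2 * m 6 + 1 / 6 * m 18 - 1 / 6 * m 19))
  | 26 => -(x 0 * (2 / 3 * lam ^ 2 * m 8 + 1 / 3 * m 21)
      + x 1 * (2 / 3 * lam ^ 2 * m 9 + 1 / 3 * m 22)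
      + x 2 * (2 / 3 * lam ^ 2 * m 7 + 1 / 3 * m 20))
  | ⟨n + 27, h⟩ => absurd h (by omega)

theorem d3q27Streaming_add (lam : ℝ) (x : Fin 3 → ℝ) (m m' : Fin 27 → ℝ) :
    d3q27Streaming lam x (m + m') = d3q27Streaming lam x m + d3q27Streaming lam x m' := by
  funext k
  fin_cases k <;> simp only [Fin.reduceFinMk, d3q27Streaming, Pi.add_apply] <;> ring

theorem d3q27Streaming_smul (lam : ℝ) (x : Fin 3 → ℝ) (r : ℝ) (m : Fin 27 → ℝ) :
    d3q27Streaming lam x (r • m) = r • d3q27Streaming lam x m := by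
  funext k
  fin_cases k <;> simp only [Fin.reduceFinMk, d3q27Streaming, Pi.smul_apply, smul_eq_mul] <;> ring

theorem d3q27Velocity_pow_three (lam : ℝ) (j : Fin 27) (a : Fin 3) :
    d3q27Velocity lam j a ^ 3 = lam ^ 2 * d3q27Velocity lam j a := by
  rw [d3q27Velocity]
  have h : j.val / 3 ^ a.val % 3 < 3 := Nat.mod_lt _ (by norm_num)
  interval_cases j.val / 3 ^ a.val % 3 <;> push_cast <;> ring

/-- The entries of `d3q27Poly`, by cases on the number of the moment. -/
theorem d3q27Poly_eq (lam : ℝ) (w : Fin 3 → ℝ) :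
    d3q27Poly lam w = fun
  | 0 => 1
  | 1 => w 0
  | 2 => w 1
  | 3 => w 2
  | 4 => (w 0 ^ 2 + w 1 ^ 2 + w 2 ^ 2) - 2 * lam ^ 2
  | 5 => 2 * w 0 ^ 2 - w 1 ^ 2 - w 2 ^ 2
  | 6 => w 1 ^ 2 - w 2 ^ 2
  | 7 => w 0 * w 1
  | 8 => w 1 * w 2
  | 9 => w 2 * w 0
  | 10 => w 0 * (3 * (w 0 ^ 2 + w 1 ^ 2 + w 2 ^ 2) - 7 * lam ^ 2)
  | 11 => w 1 * (3 * (w 0 ^ 2 + w 1 ^ 2 + w 2 ^ 2) - 7 * lam ^ 2)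
  | 12 => w 2 * (3 * (w 0 ^ 2 + w 1 ^ 2 + w 2 ^ 2) - 7 * lam ^ 2)
  | 13 => w 0 * (9 * (w 0 ^ 2 + w 1 ^ 2 + w 2 ^ 2) ^ 2 - 39 * lam ^ 2
      * (w 0 ^ 2 + w 1 ^ 2 + w 2 ^ 2) + 38 * lam ^ 4) / 2
  | 14 => w 1 * (9 * (w 0 ^ 2 + w 1 ^ 2 + w 2 ^ 2) ^ 2 - 39 * lam ^ 2
      * (w 0 ^ 2 + w 1 ^ 2 + w 2 ^ 2) + 38 * lam ^ 4) / 2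
  | 15 => w 2 * (9 * (w 0 ^ 2 + w 1 ^ 2 + w 2 ^ 2) ^ 2 - 39 * lam ^ 2
      * (w 0 ^ 2 + w 1 ^ 2 + w 2 ^ 2) + 38 * lam ^ 4) / 2
  | 16 => (3 * (w 0 ^ 2 + w 1 ^ 2 + w 2 ^ 2) ^ 2 - 11 * lam ^ 2
      * (w 0 ^ 2 + w 1 ^ 2 + w 2 ^ 2) + 8 * lam ^ 4) / 2
  | 17 => (9 * (w 0 ^ 2 + w 1 ^ 2 + w 2 ^ 2) ^ 3 - 45 * lam ^ 2
      * (w 0 ^ 2 + w 1 ^ 2 + w 2 ^ 2) ^ 2 + 60 * lam ^ 4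
      * (w 0 ^ 2 + w 1 ^ 2 + w 2 ^ 2) - 16 * lam ^ 6) / 2
  | 18 => (2 * w 0 ^ 2 - w 1 ^ 2 - w 2 ^ 2) * (3 * (w 0 ^ 2 + w 1 ^ 2 + w 2 ^ 2) - 5 * lam ^ 2)
  | 19 => (w 1 ^ 2 - w 2 ^ 2) * (3 * (w 0 ^ 2 + w 1 ^ 2 + w 2 ^ 2) - 5 * lam ^ 2)
  | 20 => w 0 * w 1 * (3 * (w 0 ^ 2 + w 1 ^ 2 + w 2 ^ 2) - 8 * lam ^ 2)
  | 21 => w 1 * w 2 * (3 * (w 0 ^ 2 + w 1 ^ 2 + w 2 ^ 2) - 8 * lam ^ 2)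
  | 22 => w 2 * w 0 * (3 * (w 0 ^ 2 + w 1 ^ 2 + w 2 ^ 2) - 8 * lam ^ 2)
  | 23 => w 0 * (w 1 ^ 2 - w 2 ^ 2)
  | 24 => w 1 * (w 2 ^ 2 - w 0 ^ 2)
  | 25 => w 2 * (w 0 ^ 2 - w 1 ^ 2)
  | 26 => w 0 * w 1 * w 2
  | ⟨n + 27, h⟩ => absurd h (by omega) := by
  funext k
  fin_cases k <;> rfl

-- Multiplying a moment polynomial by a coordinate and reducing with `w³ = λ² w` gives a combination
-- of moment polynomials; the table of `d3q27Streaming` records these combinations.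
set_option maxHeartbeats 4000000 in
theorem d3q27Streaming_poly (lam : ℝ) (x w : Fin 3 → ℝ)
    (h0 : w 0 ^ 3 = lam ^ 2 * w 0) (h1 : w 1 ^ 3 = lam ^ 2 * w 1)
    (h2 : w 2 ^ 3 = lam ^ 2 * w 2) (k : Fin 27) :
    d3q27Streaming lam x (d3q27Poly lam w) k =
      -(w 0 * x 0 + w 1 * x 1 + w 2 * x 2) * d3q27Poly lam w k := by
  rw [d3q27Poly_eq]
  fin_cases k <;> simp only [d3q27Streaming] <;> grind

/-- `d3q27Streaming` as a linear map. -/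
def d3q27StreamingLin (lam : ℝ) (x : Fin 3 → ℝ) : (Fin 27 → ℝ) →ₗ[ℝ] (Fin 27 → ℝ) where
  toFun := d3q27Streaming lam x
  map_add' := d3q27Streaming_add lam x
  map_smul' := d3q27Streaming_smul lam x

theorem d3q27Streaming_M_mulVec (lam alpha gam : ℝ) (s : Fin 27 → ℝ) (x : Fin 3 → ℝ)
    (f : Fin 27 → ℝ) :
    d3q27Streaming lam x ((d3q27 lam alpha gam s).M.mulVec f) =
      (d3q27 lam alpha gam s).M.mulVec fun j =>
        -(d3q27Velocity lam j 0 * x 0 + d3q27Velocity lam j 1 * x 1 + d3q27Velocity lam j 2 * x 2)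
          * f j := by
  have h : ∀ g : Fin 27 → ℝ, (d3q27 lam alpha gam s).M.mulVec g =
      ∑ j, g j • d3q27Poly lam (d3q27Velocity lam j) := by
    intro g
    funext k
    simp [Matrix.mulVec, dotProduct, d3q27, mul_comm]
  rw [h, h]
  change d3q27StreamingLin lam x _ = _
  rw [map_sum]
  refine Finset.sum_congr rfl fun j _ => ?_
  rw [map_smul]
  funext k
  change f j * d3q27Streaming lam x _ k = _
  rw [d3q27Streaming_poly _ _ _ (d3q27Velocity_pow_three _ _ _) (d3q27Velocity_pow_three _ _ _)
    (d3q27Velocity_pow_three _ _ _), Pi.smul_apply, smul_eq_mul]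
  ring

theorem d3q27Velocity_ternary (lam : ℝ) (j : Fin 27) :
    d3q27Velocity lam j 0 * 1 + d3q27Velocity lam j 1 * 3 + d3q27Velocity lam j 2 * 9 =
      lam * ((j.val : ℝ) - 13) := by
  -- These are the three base 3 digits of `j < 27`; the offset `13 = 1 + 3 + 9` comes from shifting
  -- each digit by one.
  have h : j.val / 3 ^ 0 % 3 + j.val / 3 ^ 1 % 3 * 3 + j.val / 3 ^ 2 % 3 * 9 = j.val := by omega
  have h' : ((j.val / 3 ^ 0 % 3 : ℕ) : ℝ) + ((j.val / 3 ^ 1 % 3 : ℕ) : ℝ) * 3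
      + ((j.val / 3 ^ 2 % 3 : ℕ) : ℝ) * 9 = j.val := by exact_mod_cast h
  simp only [d3q27Velocity, Fin.val_zero, Fin.val_one, Fin.val_two]
  linear_combination lam * h'

/-- In the direction `(1, 3, 9)` the 27 velocities have distinct eigenvalues `-λ (j - 13)`. The
streaming operator multiplies the weights of a vanishing combination of columns by these eigenvalues
and keeps it zero. Reading moment 0, a row of ones, gives a Vandermonde system. -/
theorem isUnit_d3q27_M (lam alpha gam : ℝ) (s : Fin 27 → ℝ) (hlam : lam ≠ 0) :
    IsUnit (d3q27 lam alpha gam s).M := by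
  rw [← Matrix.mulVec_injective_iff_isUnit]
  refine (injective_iff_map_eq_zero (Matrix.mulVecLin (d3q27 lam alpha gam s).M)).2 fun f hf => ?_
  rw [Matrix.mulVecLin_apply] at hf
  have hn : ∀ n : ℕ, (d3q27 lam alpha gam s).M.mulVec
      (fun j => (-(lam * ((j.val : ℝ) - 13))) ^ n * f j) = 0 := by
    intro n
    induction n with
    | zero => simpa using hf
    | succ n ih =>
      have h := d3q27Streaming_M_mulVec lam alpha gam s ![1, 3, 9] _
        |>.symm.trans (congrArg (d3q27Streaming lam ![1, 3, 9]) ih)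
      have h0 : d3q27Streaming lam ![1, 3, 9] 0 = 0 := (d3q27StreamingLin lam ![1, 3, 9]).map_zero
      rw [h0] at h
      rw [← h]
      congr 1
      funext j
      have h1 := d3q27Velocity_ternary lam j
      have h2 : (![1, 3, 9] : Fin 3 → ℝ) 2 = 9 := rfl
      rw [h2, Matrix.cons_val_one, Matrix.cons_val_zero, Matrix.cons_val_zero, h1]
      ring
  refine Matrix.eq_zero_of_forall_pow_sum_mul_pow_eq_zero
    (f := fun j : Fin 27 => -(lam * ((j.val : ℝ) - 13))) ?_ ?_
  · intro i j hij
    have h1 : lam * ((i.val : ℝ) - j.val) = 0 := by linear_combination -hij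
    have h2 : (i.val : ℝ) = j.val := by
      rcases mul_eq_zero.1 h1 with h | h
      · exact absurd h hlam
      · linarith
    exact Fin.ext (by exact_mod_cast h2)
  · intro n
    have h := congrFun (hn n) 0
    simpa [Matrix.mulVec, dotProduct, d3q27, d3q27Poly, mul_comm] using h

/-! ### Symbols of differential operators at real frequencies. -/

namespace LBScheme

variable {d N p : ℕ}

/-- The value of a matrix of differential operators, with symbol evaluated at `x`, on a vector. -/
def symbolVec {m n : ℕ} (P : Matrix (Fin m) (Fin n) (MvPolynomial (Fin d) ℝ)) (x : Fin d → ℝ)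
    (c : Fin n → ℝ) : Fin m → ℝ :=
  (P.map (eval x)).mulVec c

theorem symbolVec_mul {m n l : ℕ} (P : Matrix (Fin m) (Fin n) (MvPolynomial (Fin d) ℝ))
    (Q : Matrix (Fin n) (Fin l) (MvPolynomial (Fin d) ℝ)) (x : Fin d → ℝ) (c : Fin l → ℝ) :
    symbolVec (P * Q) x c = symbolVec P x (symbolVec Q x c) := by
  rw [symbolVec, Matrix.map_mul, ← Matrix.mulVec_mulVec]; rfl

theorem symbolVec_add {m n : ℕ} (P Q : Matrix (Fin m) (Fin n) (MvPolynomial (Fin d) ℝ))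
    (x : Fin d → ℝ) (c : Fin n → ℝ) :
    symbolVec (P + Q) x c = symbolVec P x c + symbolVec Q x c := by
  rw [symbolVec, Matrix.map_add _ (fun a b => map_add _ a b), Matrix.add_mulVec]; rfl

theorem symbolVec_sub {m n : ℕ} (P Q : Matrix (Fin m) (Fin n) (MvPolynomial (Fin d) ℝ))
    (x : Fin d → ℝ) (c : Fin n → ℝ) :
    symbolVec (P - Q) x c = symbolVec P x c - symbolVec Q x c := by
  rw [symbolVec, Matrix.map_sub _ (fun a b => map_sub _ a b), Matrix.sub_mulVec]; rfl

theorem symbolVec_smul {m n : ℕ} (r : ℝ) (P : Matrix (Fin m) (Fin n) (MvPolynomial (Fin d) ℝ))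
    (x : Fin d → ℝ) (c : Fin n → ℝ) :
    symbolVec (r • P) x c = r • symbolVec P x c := by
  have h : (r • P).map (eval x) = r • P.map (eval x) := by
    ext i j; simp [smul_eval]
  rw [symbolVec, h, Matrix.smul_mulVec]; rfl

/-- A real polynomial is determined by its values since `ℝ` is infinite, so operators can be
compared pointwise on vectors. -/
theorem ext_symbolVec {m n : ℕ} {P Q : Matrix (Fin m) (Fin n) (MvPolynomial (Fin d) ℝ)}
    (h : ∀ x c, symbolVec P x c = symbolVec Q x c) : P = Q := by
  ext1 i j
  refine MvPolynomial.funext fun x => ?_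
  have h1 : P.map (eval x) = Q.map (eval x) := Matrix.mulVec_injective (funext fun c => h x c)
  exact congrFun (congrFun h1 i) j

end LBScheme

open LBScheme

theorem symbolVec_streamingMatrix (lam alpha gam : ℝ) (s : Fin 27 → ℝ) (hlam : lam ≠ 0)
    (x : Fin 3 → ℝ) (c : Fin 27 → ℝ) :
    symbolVec (d3q27 lam alpha gam s).streamingMatrix x c = d3q27Streaming lam x c := by
  have hM := isUnit_d3q27_M lam alpha gam s hlam
  have h1 : ∀ A : Matrix (Fin 27) (Fin 27) ℝ,
      (A.map (C : ℝ → MvPolynomial (Fin 3) ℝ)).map (eval x) = A := by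
    intro A; ext i j; simp
  obtain ⟨f, rfl⟩ : ∃ f, (d3q27 lam alpha gam s).M.mulVec f = c :=
    -- Writing `c = M f` makes both sides `M` applied to `-(v · x) f`, so the entries of `M⁻¹` are
    -- never needed.
    ⟨(d3q27 lam alpha gam s).M⁻¹.mulVec c, by
      rw [Matrix.mulVec_mulVec, Matrix.mul_nonsing_inv _ ((Matrix.isUnit_iff_isUnit_det _).1 hM),
        Matrix.one_mulVec]⟩
  rw [d3q27Streaming_M_mulVec, streamingMatrix, symbolVec_mul, symbolVec_mul]
  have h2 : symbolVec ((d3q27 lam alpha gam s).M⁻¹.map C) x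
      ((d3q27 lam alpha gam s).M.mulVec f) = f := by
    rw [symbolVec, h1, Matrix.mulVec_mulVec,
      Matrix.nonsing_inv_mul _ ((Matrix.isUnit_iff_isUnit_det _).1 hM), Matrix.one_mulVec]
  rw [h2]
  have h3 : ∀ g, symbolVec ((d3q27 lam alpha gam s).M.map C) x g =
      (d3q27 lam alpha gam s).M.mulVec g := by
    intro g; rw [symbolVec, h1]
  rw [h3]
  congr 1
  funext j
  simp [symbolVec, Matrix.mulVec, dotProduct, Matrix.diagonal_apply, apply_ite (eval x)]
  simp [advection, d3q27, Fin.sum_univ_three]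

/-! ### The first three orders of the expansion of D3Q27. -/

/-- The equilibrium values of all the moments in terms of `W`. -/
def d3q27EqVec (lam al gam : ℝ) (c : Fin 4 → ℝ) : Fin 27 → ℝ
  | 0 => c 0
  | 1 => c 1
  | 2 => c 2
  | 3 => c 3
  | 4 => al * lam ^ 2 * c 0
  | 10 => -2 * lam ^ 2 * c 1
  | 11 => -2 * lam ^ 2 * c 2
  | 12 => -2 * lam ^ 2 * c 3
  | 13 => 2 * lam ^ 4 * c 1
  | 14 => 2 * lam ^ 4 * c 2
  | 15 => 2 * lam ^ 4 * c 3
  | 16 => -(2 + 3 * al) * lam ^ 4 * c 0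
  | 17 => gam * lam ^ 6 * c 0
  | _ => 0

/-- The relations between the operators `a l = α_l` and the defects `z l` of the first four orders
of the formal expansion of the D3Q27 scheme, with symbols evaluated at `x`. -/
structure IsD3Q27Expansion (lam al gam : ℝ) (x : Fin 3 → ℝ) (σ : Fin 27 → ℝ)
    (a : ℕ → (Fin 4 → ℝ) → Fin 4 → ℝ) (z : ℕ → (Fin 4 → ℝ) → Fin 27 → ℝ) : Prop where
  top0 : ∀ l c, z l c 0 = 0
  top1 : ∀ l c, z l c 1 = 0
  top2 : ∀ l c, z l c 2 = 0
  top3 : ∀ l c, z l c 3 = 0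
  one : ∀ c, z 1 c = d3q27Streaming lam x (d3q27EqVec lam al gam c)
    - d3q27EqVec lam al gam (a 1 c)
  two : ∀ c, z 2 c = d3q27Streaming lam x (σ * z 1 c) - σ * z 1 (a 1 c)
    - d3q27EqVec lam al gam (a 2 c)
  three : ∀ c, z 3 c = d3q27Streaming lam x (σ * z 2 c) - σ * z 2 (a 1 c) - σ * z 1 (a 2 c)
    - d3q27EqVec lam al gam (a 3 c)
    - (1 / 12 : ℝ) • (d3q27Streaming lam x (d3q27Streaming lam x (z 1 c))
      - (2 : ℝ) • d3q27Streaming lam x (z 1 (a 1 c)) + z 1 (a 1 (a 1 c)))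
  four : ∀ c, z 4 c = d3q27Streaming lam x (σ * z 3 c) - σ * z 3 (a 1 c) - σ * z 2 (a 2 c)
    - σ * z 1 (a 3 c) - d3q27EqVec lam al gam (a 4 c)
    - (1 / 12 : ℝ) • (d3q27Streaming lam x (d3q27Streaming lam x (z 2 c))
      - (2 : ℝ) • d3q27Streaming lam x (z 2 (a 1 c)) + z 2 (a 1 (a 1 c))
      - (2 : ℝ) • d3q27Streaming lam x (z 1 (a 2 c)) + z 1 (a 1 (a 2 c) + a 2 (a 1 c)))

/-- The defect of order one. -/
def d3q27DefectOne (lam al gam : ℝ) (x : Fin 3 → ℝ) (c : Fin 4 → ℝ) : Fin 27 → ℝ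
  | 4 => lam ^ 2 * (al + 1 / 3) * (x 0 * c 1 + x 1 * c 2 + x 2 * c 3)
  | 5 => -(2 / 3) * lam ^ 2 * (2 * x 0 * c 1 - x 1 * c 2 - x 2 * c 3)
  | 6 => -(2 / 3) * lam ^ 2 * (x 1 * c 2 - x 2 * c 3)
  | 7 => -(1 / 3) * lam ^ 2 * (x 0 * c 2 + x 1 * c 1)
  | 8 => -(1 / 3) * lam ^ 2 * (x 1 * c 3 + x 2 * c 2)
  | 9 => -(1 / 3) * lam ^ 2 * (x 2 * c 1 + x 0 * c 3)
  | 13 => 1 / 3 * lam ^ 6 * (8 * al + 8 - gam) * x 0 * c 0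
  | 14 => 1 / 3 * lam ^ 6 * (8 * al + 8 - gam) * x 1 * c 0
  | 15 => 1 / 3 * lam ^ 6 * (8 * al + 8 - gam) * x 2 * c 0
  | 16 => -(2 + 3 * al) * lam ^ 4 * (x 0 * c 1 + x 1 * c 2 + x 2 * c 3)
  | 17 => (gam - 2) * lam ^ 6 * (x 0 * c 1 + x 1 * c 2 + x 2 * c 3)
  | 18 => lam ^ 4 * (2 * x 0 * c 1 - x 1 * c 2 - x 2 * c 3)
  | 19 => lam ^ 4 * (x 1 * c 2 - x 2 * c 3)
  | _ => 0

/-- The components of the defect of order two that contribute to the operators of order at most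
four, as functions of the parameters of Hénon of the moments `4`, `5`, `16` and `18`. -/
def d3q27DefectTwo (lam al F S P T : ℝ) (x : Fin 3 → ℝ) (c : Fin 4 → ℝ) : Fin 27 → ℝ
  | 4 => lam ^ 4 * (al + 1 / 3) * ((al + 2) / 3) * F * (x 0 ^ 2 + x 1 ^ 2 + x 2 ^ 2) * c 0
  | 5 => -(2 / 9) * lam ^ 4 * (al + 2) * S * (2 * x 0 ^ 2 - x 1 ^ 2 - x 2 ^ 2) * c 0
  | 6 => -(2 / 9) * lam ^ 4 * (al + 2) * S * (x 1 ^ 2 - x 2 ^ 2) * c 0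
  | 7 => -(2 / 9) * lam ^ 4 * (al + 2) * S * (x 0 * x 1) * c 0
  | 8 => -(2 / 9) * lam ^ 4 * (al + 2) * S * (x 1 * x 2) * c 0
  | 9 => -(2 / 9) * lam ^ 4 * (al + 2) * S * (x 2 * x 0) * c 0
  | 10 => lam ^ 4 * ((2 * al * (P - F) + 4 / 3 * P - 2 / 3 * F + S + 1 / 3 * T) * x 0
        * (x 0 * c 1 + x 1 * c 2 + x 2 * c 3)
      + S * (x 0 ^ 2 + x 1 ^ 2 + x 2 ^ 2) * c 1 - (2 * S + T) * x 0 ^ 2 * c 1)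
  | 11 => lam ^ 4 * ((2 * al * (P - F) + 4 / 3 * P - 2 / 3 * F + S + 1 / 3 * T) * x 1
        * (x 0 * c 1 + x 1 * c 2 + x 2 * c 3)
      + S * (x 0 ^ 2 + x 1 ^ 2 + x 2 ^ 2) * c 2 - (2 * S + T) * x 1 ^ 2 * c 2)
  | 12 => lam ^ 4 * ((2 * al * (P - F) + 4 / 3 * P - 2 / 3 * F + S + 1 / 3 * T) * x 2
        * (x 0 * c 1 + x 1 * c 2 + x 2 * c 3)
      + S * (x 0 ^ 2 + x 1 ^ 2 + x 2 ^ 2) * c 3 - (2 * S + T) * x 2 ^ 2 * c 3)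
  | 23 => lam ^ 4 * ((5 / 9 * S - 1 / 3 * T) * x 0 * (x 1 * c 2 - x 2 * c 3)
      + 1 / 9 * S * (x 1 ^ 2 - x 2 ^ 2) * c 1)
  | 24 => lam ^ 4 * ((5 / 9 * S - 1 / 3 * T) * x 1 * (x 2 * c 3 - x 0 * c 1)
      + 1 / 9 * S * (x 2 ^ 2 - x 0 ^ 2) * c 2)
  | 25 => lam ^ 4 * ((5 / 9 * S - 1 / 3 * T) * x 2 * (x 0 * c 1 - x 1 * c 2)
      + 1 / 9 * S * (x 0 ^ 2 - x 1 ^ 2) * c 3)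
  | 26 => 4 / 9 * lam ^ 4 * S * (x 0 * x 1 * c 3 + x 0 * x 2 * c 2 + x 1 * x 2 * c 1)
  | _ => 0

namespace IsD3Q27Expansion

variable {lam al gam : ℝ} {x : Fin 3 → ℝ} {σ : Fin 27 → ℝ}
  {a : ℕ → (Fin 4 → ℝ) → Fin 4 → ℝ} {z : ℕ → (Fin 4 → ℝ) → Fin 27 → ℝ}

theorem alpha_one (h : IsD3Q27Expansion lam al gam x σ a z) (c : Fin 4 → ℝ) :
    a 1 c = ![-(x 0 * c 1 + x 1 * c 2 + x 2 * c 3), -((al + 2) / 3) * lam ^ 2 * x 0 * c 0,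
      -((al + 2) / 3) * lam ^ 2 * x 1 * c 0, -((al + 2) / 3) * lam ^ 2 * x 2 * c 0] := by
  have h0 := (h.top0 1 c).symm.trans (congrFun (h.one c) 0)
  have h1 := (h.top1 1 c).symm.trans (congrFun (h.one c) 1)
  have h2 := (h.top2 1 c).symm.trans (congrFun (h.one c) 2)
  have h3 := (h.top3 1 c).symm.trans (congrFun (h.one c) 3)
  simp only [Pi.sub_apply, d3q27Streaming, d3q27EqVec] at h0 h1 h2 h3
  funext i
  fin_cases i
  · simp; linear_combination h0
  · simp; linear_combination h1
  · simp; linear_combination h2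
  · simp; linear_combination h3

/-- The equilibria are tuned here: those of `ε₂` and `q` cancel the components 10 to 12, and those
of `q` and `r` the components 20 to 22. The latter is why `σ 20`, `σ 21`, `σ 22` are absent from the
components of order two used later. -/
theorem defect_one (h : IsD3Q27Expansion lam al gam x σ a z) (c : Fin 4 → ℝ) :
    z 1 c = d3q27DefectOne lam al gam x c := by
  rw [h.one, h.alpha_one]
  funext k
  fin_cases k <;> simp [d3q27Streaming, d3q27EqVec, d3q27DefectOne] <;> ring

theorem alpha_two (h : IsD3Q27Expansion lam al gam x σ a z) (h6 : σ 6 = σ 5) (h7 : σ 7 = σ 5)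
    (h8 : σ 8 = σ 5) (h9 : σ 9 = σ 5) (c : Fin 4 → ℝ) :
    a 2 c = fun i => lam ^ 2 * (![0, 1 / 3 * σ 5 * (x 0 ^ 2 + x 1 ^ 2 + x 2 ^ 2) * c 1
        + 1 / 9 * (σ 5 - (1 + 3 * al) * σ 4) * x 0 * (x 0 * c 1 + x 1 * c 2 + x 2 * c 3),
      1 / 3 * σ 5 * (x 0 ^ 2 + x 1 ^ 2 + x 2 ^ 2) * c 2
        + 1 / 9 * (σ 5 - (1 + 3 * al) * σ 4) * x 1 * (x 0 * c 1 + x 1 * c 2 + x 2 * c 3),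
      1 / 3 * σ 5 * (x 0 ^ 2 + x 1 ^ 2 + x 2 ^ 2) * c 3
        + 1 / 9 * (σ 5 - (1 + 3 * al) * σ 4) * x 2 * (x 0 * c 1 + x 1 * c 2 + x 2 * c 3)] i) := by
  have h0 := (h.top0 2 c).symm.trans (congrFun (h.two c) 0)
  have h1 := (h.top1 2 c).symm.trans (congrFun (h.two c) 1)
  have h2 := (h.top2 2 c).symm.trans (congrFun (h.two c) 2)
  have h3 := (h.top3 2 c).symm.trans (congrFun (h.two c) 3)
  simp only [Pi.sub_apply, Pi.mul_apply, d3q27Streaming, d3q27EqVec, h.defect_one,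
    d3q27DefectOne, h6, h7, h8, h9] at h0 h1 h2 h3
  funext i
  fin_cases i
  · simp; linear_combination h0
  · simp; linear_combination h1
  · simp; linear_combination h2
  · simp; linear_combination h3

theorem defect_two (h : IsD3Q27Expansion lam al gam x σ a z) (h6 : σ 6 = σ 5) (h7 : σ 7 = σ 5)
    (h8 : σ 8 = σ 5) (h9 : σ 9 = σ 5) (h19 : σ 19 = σ 18) (c : Fin 4 → ℝ) {k : Fin 27}
    (hk : k ∈ ({4, 5, 6, 7, 8, 9, 10, 11, 12, 23, 24, 25, 26} : Finset (Fin 27))) :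
    z 2 c k = d3q27DefectTwo lam al (σ 4) (σ 5) (σ 16) (σ 18) x c k := by
  have h1 := congrFun (h.two c) k
  rw [h1, h.alpha_one, h.alpha_two h6 h7 h8 h9]
  simp only [Finset.mem_insert, Finset.mem_singleton] at hk
  rcases hk with rfl | rfl | rfl | rfl | rfl | rfl | rfl | rfl | rfl | rfl | rfl | rfl | rfl <;>
    simp [d3q27Streaming, d3q27EqVec, d3q27DefectTwo, h.defect_one, d3q27DefectOne,
      h6, h7, h8, h9, h19] <;> ring

theorem alpha_three (h : IsD3Q27Expansion lam al gam x σ a z) (h6 : σ 6 = σ 5) (h7 : σ 7 = σ 5)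
    (h8 : σ 8 = σ 5) (h9 : σ 9 = σ 5) (h19 : σ 19 = σ 18) (c : Fin 4 → ℝ) :
    a 3 c = fun i => -(lam ^ 2 * (x 0 ^ 2 + x 1 ^ 2 + x 2 ^ 2)) *
      (![(al - 1) / 36 * (x 0 * c 1 + x 1 * c 2 + x 2 * c 3),
        (al + 2) / 54 * (1 - al + 6 * al * σ 4 ^ 2 + 2 * σ 4 ^ 2 - 8 * σ 5 ^ 2) * lam ^ 2
          * x 0 * c 0,
        (al + 2) / 54 * (1 - al + 6 * al * σ 4 ^ 2 + 2 * σ 4 ^ 2 - 8 * σ 5 ^ 2) * lam ^ 2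
          * x 1 * c 0,
        (al + 2) / 54 * (1 - al + 6 * al * σ 4 ^ 2 + 2 * σ 4 ^ 2 - 8 * σ 5 ^ 2) * lam ^ 2
          * x 2 * c 0] i) := by
  have h0 := (h.top0 3 c).symm.trans (congrFun (h.three c) 0)
  have h1 := (h.top1 3 c).symm.trans (congrFun (h.three c) 1)
  have h2 := (h.top2 3 c).symm.trans (congrFun (h.three c) 2)
  have h3 := (h.top3 3 c).symm.trans (congrFun (h.three c) 3)
  have hz : ∀ k ∈ ({4, 5, 6, 7, 8, 9, 10, 11, 12, 23, 24, 25, 26} : Finset (Fin 27)),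
    z 2 c k = d3q27DefectTwo lam al (σ 4) (σ 5) (σ 16) (σ 18) x c k :=
    fun k hk => h.defect_two h6 h7 h8 h9 h19 c hk
  simp only [Finset.forall_mem_insert, Finset.mem_singleton, forall_eq] at hz
  simp [d3q27Streaming, d3q27EqVec, hz, d3q27DefectTwo, h.defect_one, d3q27DefectOne,
      h6, h7, h8, h9, h.top0, h.top1, h.top2, h.top3, h.alpha_one] at h0 h1 h2 h3
  funext i
  fin_cases i
  · simp; linear_combination h0
  · simp; linear_combination h1
  · simp; linear_combination h2
  · simp; linear_combination h3

end IsD3Q27Expansion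

/-! ### Isotropy of the fourth order terms. -/

/-- The conditions on the parameters of Hénon `F`, `S`, `A`, `P`, `T`, `B`, `G` of the moments
`4`, `5`, `10`, `16`, `18`, `23`, `26` that make the fourth order terms of the momentum equation
isotropic. The names of the fields give the monomials of the first component: for instance,
`v_xxxy` refers to `∂_x ^ 3 ∂_y` acting on the second component of the momentum. -/
structure IsIsotropicFourthOrder (al F S A P T B G m4 z4 : ℝ) : Prop where
  u_xxxx : -72 * al ^ 2 * F ^ 3 + 12 * al ^ 2 * F + 48 * al * S ^ 3 + 48 * al * S ^ 2 * F
    + 48 * al * S * F ^ 2 + 72 * al * S * F * A - 72 * al * S * A * P - 16 * al * S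
    - 108 * al * F ^ 3 - 72 * al * F ^ 2 * A + 72 * al * F * A * P + 19 * al * F + 32 * S ^ 3
    + 16 * S ^ 2 * F + 24 * S * T * A + 16 * S * F ^ 2 + 24 * S * F * A - 48 * S * A * P - 20 * S
    - 24 * T * F * A - 28 * F ^ 3 - 24 * F ^ 2 * A + 48 * F * A * P + 5 * F
      = 324 * -(m4 + z4)
  u_xxyy : -72 * al ^ 2 * F ^ 3 + 12 * al ^ 2 * F + 48 * al * S ^ 3 + 48 * al * S ^ 2 * F
    + 48 * al * S * F ^ 2 - 252 * al * S * F * A + 252 * al * S * A * P - 16 * al * S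
    - 108 * al * F ^ 3 - 72 * al * F ^ 2 * A + 72 * al * F * A * P + 46 * al * F - 27 * al * P
    - 4 * S ^ 3 + 16 * S ^ 2 * F + 36 * S ^ 2 * A + 180 * S ^ 2 * B - 12 * S * T * A
    - 108 * S * T * B + 16 * S * F ^ 2 - 12 * S * F * A + 168 * S * A * P - 56 * S
    + 12 * T * F * A + 9 * T - 28 * F ^ 3 - 24 * F ^ 2 * A + 48 * F * A * P + 5 * F - 18 * P
      = 324 * -(2 * m4 + z4)
  u_yyyy : -36 * S ^ 3 + 54 * S ^ 2 * A + 18 * S ^ 2 * B - 9 * S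
      = 324 * -m4
  u_yyzz : -72 * S ^ 3 + 108 * S ^ 2 * A - 36 * S ^ 2 * B + 288 * S ^ 2 * G - 54 * S
      = 324 * -(2 * m4)
  v_xxxy : -72 * al ^ 2 * F ^ 3 + 12 * al ^ 2 * F + 48 * al * S ^ 3 + 48 * al * S ^ 2 * F
    + 48 * al * S * F ^ 2 + 72 * al * S * F * A - 72 * al * S * A * P - 16 * al * S
    - 108 * al * F ^ 3 - 72 * al * F ^ 2 * A + 72 * al * F * A * P + 19 * al * F + 68 * S ^ 3
    + 16 * S ^ 2 * F + 36 * S ^ 2 * A + 36 * S ^ 2 * B - 12 * S * T * A + 16 * S * F ^ 2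
    + 96 * S * F * A - 48 * S * A * P - 38 * S + 12 * T * F * A - 28 * F ^ 3 - 24 * F ^ 2 * A
    + 48 * F * A * P - 4 * F
      = 324 * -z4
  v_xyyy : -72 * al ^ 2 * F ^ 3 + 12 * al ^ 2 * F + 48 * al * S ^ 3 + 48 * al * S ^ 2 * F
    + 48 * al * S * F ^ 2 - 252 * al * S * F * A + 252 * al * S * A * P - 16 * al * S
    - 108 * al * F ^ 3 - 72 * al * F ^ 2 * A + 72 * al * F * A * P + 46 * al * F - 27 * al * P
    + 68 * S ^ 3 + 16 * S ^ 2 * F + 54 * S ^ 2 * A + 90 * S ^ 2 * B - 30 * S * T * A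
    - 54 * S * T * B + 16 * S * F ^ 2 - 84 * S * F * A + 168 * S * A * P - 47 * S - 24 * T * F * A
    + 9 * T - 28 * F ^ 3 - 24 * F ^ 2 * A + 48 * F * A * P + 14 * F - 18 * P
      = 324 * -z4
  v_xyzz : -72 * al ^ 2 * F ^ 3 + 12 * al ^ 2 * F + 48 * al * S ^ 3 + 48 * al * S ^ 2 * F
    + 48 * al * S * F ^ 2 - 252 * al * S * F * A + 252 * al * S * A * P - 16 * al * S
    - 108 * al * F ^ 3 - 72 * al * F ^ 2 * A + 72 * al * F * A * P + 46 * al * F - 27 * al * P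
    + 68 * S ^ 3 + 16 * S ^ 2 * F + 198 * S ^ 2 * A - 306 * S ^ 2 * B + 288 * S ^ 2 * G
    + 42 * S * T * A + 162 * S * T * B + 16 * S * F ^ 2 - 12 * S * F * A + 168 * S * A * P
    - 83 * S + 12 * T * F * A - 18 * T - 28 * F ^ 3 - 24 * F ^ 2 * A + 48 * F * A * P + 5 * F
    - 18 * P
      = 324 * -z4

namespace IsD3Q27Expansion

variable {lam al gam : ℝ} {x : Fin 3 → ℝ} {σ : Fin 27 → ℝ}
  {a : ℕ → (Fin 4 → ℝ) → Fin 4 → ℝ} {z : ℕ → (Fin 4 → ℝ) → Fin 27 → ℝ}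

-- Streaming couples the momentum rows only to the moments 0 and 4 to 9, and the moments 4 to 9 only
-- to 1 to 3, 10 to 12 and 23 to 26. Hence the components of `d3q27DefectTwo` suffice, and `γ` drops
-- out.
set_option maxHeartbeats 4000000 in
theorem alpha_four (h : IsD3Q27Expansion lam al gam x σ a z) (h6 : σ 6 = σ 5) (h7 : σ 7 = σ 5)
    (h8 : σ 8 = σ 5) (h9 : σ 9 = σ 5) (h11 : σ 11 = σ 10) (h12 : σ 12 = σ 10)
    (h19 : σ 19 = σ 18) (h24 : σ 24 = σ 23) (h25 : σ 25 = σ 23) {m4 z4 : ℝ}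
    (e : IsIsotropicFourthOrder al (σ 4) (σ 5) (σ 10) (σ 16) (σ 18) (σ 23) (σ 26) m4 z4)
    (c : Fin 4 → ℝ) :
    a 4 c = fun i => lam ^ 4 * (x 0 ^ 2 + x 1 ^ 2 + x 2 ^ 2) *
      (![(al + 2) / 324 * (4 * σ 5 - (3 * al + 1) * σ 4) * (x 0 ^ 2 + x 1 ^ 2 + x 2 ^ 2) * c 0,
        -m4 * (x 0 ^ 2 + x 1 ^ 2 + x 2 ^ 2) * c 1 - z4 * x 0 * (x 0 * c 1 + x 1 * c 2 + x 2 * c 3),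
        -m4 * (x 0 ^ 2 + x 1 ^ 2 + x 2 ^ 2) * c 2 - z4 * x 1 * (x 0 * c 1 + x 1 * c 2 + x 2 * c 3),
        -m4 * (x 0 ^ 2 + x 1 ^ 2 + x 2 ^ 2) * c 3 - z4 * x 2 * (x 0 * c 1 + x 1 * c 2 + x 2 * c 3)]
        i) := by
  have h0 := (h.top0 4 c).symm.trans (congrFun (h.four c) 0)
  have h1 := (h.top1 4 c).symm.trans (congrFun (h.four c) 1)
  have h2 := (h.top2 4 c).symm.trans (congrFun (h.four c) 2)
  have h3 := (h.top3 4 c).symm.trans (congrFun (h.four c) 3)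
  have hz : ∀ k ∈ ({4, 5, 6, 7, 8, 9, 10, 11, 12, 23, 24, 25, 26} : Finset (Fin 27)), ∀ c,
    z 2 c k = d3q27DefectTwo lam al (σ 4) (σ 5) (σ 16) (σ 18) x c k :=
    fun k hk c => h.defect_two h6 h7 h8 h9 h19 c hk
  simp only [Finset.forall_mem_insert, Finset.mem_singleton, forall_eq] at hz
  simp [d3q27Streaming, d3q27EqVec, hz, d3q27DefectTwo, h.defect_one, d3q27DefectOne,
      h6, h7, h8, h9, h11, h12, h24, h25, h.top0, h.top1, h.top2, h.top3, h.alpha_one,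
      h.three, h.alpha_two h6 h7 h8 h9, h.alpha_three h6 h7 h8 h9 h19] at h0 h1 h2 h3
  funext i
  fin_cases i
  · simp; linear_combination h0
  · simp
    -- Each relation is the coefficient of one monomial, reused under the exchange of the second and
    -- third axes; the other two momentum rows follow by cyclic permutation of the axes.
    linear_combination h1 + lam ^ 4 / 324 * (x 0 ^ 4 * c 1 * e.u_xxxx
      + x 0 ^ 2 * (x 1 ^ 2 + x 2 ^ 2) * c 1 * e.u_xxyy + (x 1 ^ 4 + x 2 ^ 4) * c 1 * e.u_yyyy
      + x 1 ^ 2 * x 2 ^ 2 * c 1 * e.u_yyzz + x 0 ^ 3 * (x 1 * c 2 + x 2 * c 3) * e.v_xxxy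
      + x 0 * (x 1 ^ 3 * c 2 + x 2 ^ 3 * c 3) * e.v_xyyy
      + x 0 * x 1 * x 2 * (x 2 * c 2 + x 1 * c 3) * e.v_xyzz)
  · simp
    linear_combination h2 + lam ^ 4 / 324 * (x 1 ^ 4 * c 2 * e.u_xxxx
      + x 1 ^ 2 * (x 2 ^ 2 + x 0 ^ 2) * c 2 * e.u_xxyy + (x 2 ^ 4 + x 0 ^ 4) * c 2 * e.u_yyyy
      + x 2 ^ 2 * x 0 ^ 2 * c 2 * e.u_yyzz + x 1 ^ 3 * (x 2 * c 3 + x 0 * c 1) * e.v_xxxy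
      + x 1 * (x 2 ^ 3 * c 3 + x 0 ^ 3 * c 1) * e.v_xyyy
      + x 1 * x 2 * x 0 * (x 0 * c 3 + x 2 * c 1) * e.v_xyzz)
  · simp
    linear_combination h3 + lam ^ 4 / 324 * (x 2 ^ 4 * c 3 * e.u_xxxx
      + x 2 ^ 2 * (x 0 ^ 2 + x 1 ^ 2) * c 3 * e.u_xxyy + (x 0 ^ 4 + x 1 ^ 4) * c 3 * e.u_yyyy
      + x 0 ^ 2 * x 1 ^ 2 * c 3 * e.u_yyzz + x 2 ^ 3 * (x 0 * c 1 + x 1 * c 2) * e.v_xxxy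
      + x 2 * (x 0 ^ 3 * c 1 + x 1 ^ 3 * c 2) * e.v_xyyy
      + x 2 * x 0 * x 1 * (x 1 * c 1 + x 0 * c 2) * e.v_xyzz)

end IsD3Q27Expansion

theorem quadD_pos (psi : ℝ) : 0 < quadD psi := by
  rw [quadD]; nlinarith [sq_nonneg (6 * psi - 11)]

/-- The relations of isotropy hold for the one-parameter family. -/
theorem isIsotropicFourthOrder_family {al psi F S A P T B G m4 z4 D Q K : ℝ} (hal : 2 + 3 * al ≠ 0)
    (hK : K ≠ 0) (hD : D ≠ 0) (hQ : Q ≠ 0) (hS : S ≠ 0)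
    (eK : K = 4 * psi - 7)
    (eD : D = 3 * psi ^ 3 - 22 * psi ^ 2 + 23 * psi + 14) (eQ : Q = 3 * psi ^ 2 - 11 * psi + 14)
    (hT : T = psi * S) (hF : F = S * ((3 * psi ^ 3 - 4 * psi ^ 2 - 13 * psi + 32) / D))
    (hA : A = 1 / (12 * S) * ((3 * psi - 7) * (psi - 4) / Q))
    (hB : B = 1 / (12 * S) * ((3 * psi ^ 2 - 7 * psi + 16) / Q))
    (hG : G = 1 / (48 * S) * ((21 * psi ^ 2 - 73 * psi + 100) / Q))
    (hP : P = S *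
      ((6 * psi ^ 5 - (36 * al + 71) * psi ^ 4 + (111 * al + 211) * psi ^ 3
          + (72 * al - 195) * psi ^ 2 - (657 * al + 151) * psi + (672 * al + 308))
        / (-(2 + 3 * al) * K * D)))
    (hm : m4 = S / 108 * ((36 * psi ^ 2 * S ^ 2 - 132 * psi * S ^ 2 + 168 * S ^ 2 + 3 * psi ^ 2
      - psi - 8) / Q))
    (hz : z4 = 1 / 108 * (S / (K * Q * D ^ 3)) * zeta4Num al psi S) :
    IsIsotropicFourthOrder al F S A P T B G m4 z4 := by
  -- `P` enters the relations only through this product.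
  have hR : (2 + 3 * al) * P = S *
      ((6 * psi ^ 5 - (36 * al + 71) * psi ^ 4 + (111 * al + 211) * psi ^ 3
          + (72 * al - 195) * psi ^ 2 - (657 * al + 151) * psi + (672 * al + 308))
        / (-K * D)) := by
    rw [hP]; field_simp
  have e1 : -36 * S ^ 3 + 54 * S ^ 2 * A + 18 * S ^ 2 * B - 9 * S = 324 * -m4 := by
    rw [hA, hB, hm]; field_simp; rw [eQ]; ring
  have e2 : -72 * S ^ 3 + 108 * S ^ 2 * A - 36 * S ^ 2 * B + 288 * S ^ 2 * G - 54 * S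
      = 324 * -(2 * m4) := by
    rw [hA, hB, hG, hm]; field_simp; rw [eQ]; ring
  -- Subtracting relations cancels the long common part that contains `z4`: `e3` is `u_xxxx -
  -- v_xxxy`, `e4` is `v_xyyy - v_xxxy`, `e5` is `v_xyzz - v_xyyy` and `e7` is `u_xxyy - v_xyyy`.
  -- Only `e6` still involves `z4`.
  have e3 : -36 * S ^ 3 - 36 * S ^ 2 * A - 36 * S ^ 2 * B + 36 * S * T * A - 72 * S * F * A
      + 18 * S - 36 * T * F * A + 9 * F = 324 * -m4 := by
    rw [hA, hB, hm, hT, hF]; field_simp; rw [eQ, eD]; ring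
  -- This is linear in `P` with `12 S A - 1 = -2 (4 ψ - 7) / Q`, the origin of the factor `4 ψ - 7`
  -- in the denominator of `σ 16`.
  have e4 : 9 * (12 * S * A - 1) * ((2 + 3 * al) * P) - 324 * al * S * F * A + 27 * al * F
      + 18 * S ^ 2 * A + 54 * S ^ 2 * B - 18 * S * T * A - 54 * S * T * B - 180 * S * F * A
      - 9 * S - 36 * T * F * A + 9 * T + 18 * F = 0 := by
    rw [hR, hA, hB, hT, hF]; field_simp; rw [eQ, eD, eK]; ring
  have e5 : 144 * S ^ 2 * A - 396 * S ^ 2 * B + 288 * S ^ 2 * G + 72 * S * T * A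
      + 216 * S * T * B + 72 * S * F * A - 36 * S + 36 * T * F * A - 27 * T - 9 * F = 0 := by
    rw [hA, hB, hG, hT, hF]; field_simp; rw [eQ, eD]; ring
  have e7 : -72 * S ^ 3 - 18 * S ^ 2 * A + 90 * S ^ 2 * B + 18 * S * T * A - 54 * S * T * B
      + 72 * S * F * A - 9 * S + 36 * T * F * A - 9 * F = 324 * -(2 * m4) := by
    rw [hA, hB, hm, hT, hF]; field_simp; rw [eQ, eD]; ring
  have e6 : -72 * al ^ 2 * F ^ 3 + 12 * al ^ 2 * F + 48 * al * S ^ 3 + 48 * al * S ^ 2 * F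
    + 48 * al * S * F ^ 2 + 72 * al * S * F * A - 16 * al * S
    - 108 * al * F ^ 3 - 72 * al * F ^ 2 * A + 19 * al * F + 68 * S ^ 3
    + 16 * S ^ 2 * F + 36 * S ^ 2 * A + 36 * S ^ 2 * B - 12 * S * T * A + 16 * S * F ^ 2
    + 96 * S * F * A - 38 * S + 12 * T * F * A - 28 * F ^ 3 - 24 * F ^ 2 * A
    - 4 * F + 24 * A * (F - S) * ((2 + 3 * al) * P)
      = 324 * -z4 := by
    rw [hR, hA, hB, hT, hF, hz, zeta4Num]; field_simp; rw [eQ, eD, eK]; ring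
  constructor
  · linear_combination e3 + e6
  · linear_combination e4 + e6 + e7
  · exact e1
  · exact e2
  · linear_combination e6
  · linear_combination e4 + e6
  · linear_combination e4 + e6 + e5

/-! ### Positivity of the parameters of Hénon. -/

theorem cubicD_pos {psi : ℝ} (h0 : 0 < psi) (h1 : psi < 7 / 4) : 0 < cubicD psi := by
  have h2 := mul_pos h0 (sub_pos.2 h1)
  -- This product has no quadratic term. Removing three times it and `22 ψ (7 / 4 - ψ)` from the
  -- cubic leaves an affine function that is positive for `ψ < 7 / 4`.
  have h3 : 0 ≤ (psi - 13 / 10) ^ 2 * (psi + 13 / 5) := by positivity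
  rw [cubicD]
  nlinarith

/-- Positivity of the numerator of `σ 16` for `3 / 2 ≤ psi < 7 / 4`. -/
theorem sigma16_numerator_pos {alpha psi : ℝ} (h1 : -1 ≤ alpha) (h2 : alpha < -(2 / 3))
    (h3 : 3 / 2 ≤ psi) (h4 : psi < 7 / 4) :
    0 < 6 * psi ^ 5 - (36 * alpha + 71) * psi ^ 4 + (111 * alpha + 211) * psi ^ 3
        + (72 * alpha - 195) * psi ^ 2 - (657 * alpha + 151) * psi + (672 * alpha + 308) := by
  obtain ⟨h, rfl⟩ : ∃ h, psi = 3 / 2 + h := ⟨psi - 3 / 2, by ring⟩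
  have h5 : 0 ≤ h := by linarith
  have h6 : 0 ≤ 1 / 4 - h := by linarith
  -- The numerator is affine in `α`, so it is enough to treat the endpoints: `e1` is `α = -1` and
  -- `e2` is `α = -2 / 3`. The bound in `e1` is tight: its value at `h = 0` is `1 / 8`.
  have e1 : 0 < 6 * (3 / 2 + h) ^ 5 - 35 * (3 / 2 + h) ^ 4 + 100 * (3 / 2 + h) ^ 3
      - 267 * (3 / 2 + h) ^ 2 + 506 * (3 / 2 + h) - 364 := by
    have := mul_nonneg h5 h6
    have := mul_nonneg (mul_nonneg h5 h5) h6
    have := pow_nonneg h5 5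
    have := mul_nonneg (pow_nonneg h5 3) h6
    nlinarith
  have e2 : 0 < 6 * (3 / 2 + h) ^ 5 - 47 * (3 / 2 + h) ^ 4 + 137 * (3 / 2 + h) ^ 3
      - 243 * (3 / 2 + h) ^ 2 + 287 * (3 / 2 + h) - 140 := by
    have := mul_nonneg h5 h6
    have := mul_nonneg (mul_nonneg h5 h5) h6
    have := pow_nonneg h5 5
    have := mul_nonneg (pow_nonneg h5 3) h6
    nlinarith
  have h7 : 0 ≤ 3 * (alpha + 1) := by linarith
  have h8 : 0 < 1 - 3 * (alpha + 1) := by linarith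
  have e3 := mul_nonneg h7 e2.le
  have e4 := mul_pos h8 e1
  linarith

theorem IsFourthOrderFamily.bounds_of_positive {alpha psi : ℝ} {σ : Fin 27 → ℝ}
    (hfam : IsFourthOrderFamily alpha psi σ) (h1 : -1 ≤ alpha) (h2 : alpha < -(2 / 3))
    (h3 : psi < 7 / 4) (hpos : FamilyPositive σ) :
    0 < psi ∧ psi < 3 / 2 ∧ 1 ≤ σ 4 / σ 5 ∧ σ 4 / σ 5 < 16 / 7 ∧ (σ 4 / σ 5 = 1 ↔ psi = 1) := by
  have hS : 0 < σ 5 := hpos 5 (by decide)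
  have hpsi : 0 < psi := by rw [hfam.hpsi]; exact div_pos (hpos 18 (by decide)) hS
  have hD := cubicD_pos hpsi h3
  have hlt : psi < 3 / 2 := by
    by_contra! hge
    have hN := sigma16_numerator_pos h1 h2 hge h3
    have h16 : 0 < σ 16 := hpos 16 (by decide)
    rw [hfam.h16] at h16
    have hden : -(2 + 3 * alpha) * (4 * psi - 7) * cubicD psi < 0 :=
      mul_neg_of_neg_of_pos (mul_neg_of_pos_of_neg (by linarith) (by linarith)) hD
    exact absurd h16 (mul_neg_of_pos_of_neg hS (div_neg_of_pos_of_neg hN hden)).not_gt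
  have hr : σ 4 / σ 5 = (3 * psi ^ 3 - 4 * psi ^ 2 - 13 * psi + 32) / cubicD psi := by
    rw [hfam.h4]; field_simp
  have hr1 : σ 4 / σ 5 - 1 = 18 * (psi - 1) ^ 2 / cubicD psi := by
    rw [hr, div_sub_one hD.ne']; congr 1; rw [cubicD]; ring
  refine ⟨hpsi, hlt, ?_, ?_, ?_⟩
  · have : 0 ≤ σ 4 / σ 5 - 1 := by rw [hr1]; positivity
    linarith
  · rw [hr, div_lt_div_iff₀ hD (by norm_num), cubicD]
    -- Sixteen times the denominator minus seven times the numerator is `27 ψ (ψ² - 12 ψ + 17)`; the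
    -- value `16 / 7` is the ratio at `ψ = 0`.
    have h4 : 0 < psi ^ 2 - 12 * psi + 17 := by nlinarith
    nlinarith [mul_pos hpsi h4]
  · rw [← sub_eq_zero, hr1, div_eq_zero_iff]
    constructor
    · rintro (h | h)
      · have h5 : psi - 1 = 0 := by simpa using h
        linarith
      · exact absurd h hD.ne'
    · rintro rfl
      left; norm_num

theorem IsFourthOrderFamily.positive {psi : ℝ} {σ : Fin 27 → ℝ}
    (hfam : IsFourthOrderFamily (-1) psi σ) (hS : 0 < σ 5) (h0 : 0 < psi)
    (h1 : psi ≤ 149 / 100) : FamilyPositive σ := by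
  have hD := cubicD_pos h0 (by linarith)
  have hQ := quadD_pos psi
  have p4 : 0 < σ 4 := by
    rw [hfam.h4]
    refine mul_pos hS (div_pos ?_ hD)
    nlinarith [mul_pos h0 h0, mul_pos h0 (mul_pos h0 h0)]
  have p10 : 0 < σ 10 := by
    rw [hfam.h10]
    have : 0 < (3 * psi - 7) * (psi - 4) := mul_pos_of_neg_of_neg (by linarith) (by linarith)
    positivity
  have p23 : 0 < σ 23 := by
    rw [hfam.h23]
    have : 0 < 3 * psi ^ 2 - 7 * psi + 16 := by nlinarith [sq_nonneg (6 * psi - 7)]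
    positivity
  have p26 : 0 < σ 26 := by
    rw [hfam.h26]
    have : 0 < 21 * psi ^ 2 - 73 * psi + 100 := by nlinarith [sq_nonneg (42 * psi - 73)]
    positivity
  have p18 : 0 < σ 18 := by
    have := hfam.hpsi ▸ h0
    exact (div_pos_iff_of_pos_right hS).1 this
  have p16 : 0 < σ 16 := by
    rw [hfam.h16]
    refine mul_pos hS (div_pos_of_neg_of_neg ?_ ?_)
    -- For `α = -1` the numerator of `σ 16` is negative up to `149 / 100` and positive at `3 / 2`,
    -- hence the margin below `3 / 2`.
    · have h2 : 0 ≤ 149 / 100 - psi := by linarith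
      nlinarith [mul_nonneg (sq_nonneg (149 / 100 - psi)) h0.le,
        mul_nonneg (sq_nonneg (149 / 100 - psi)) (sq_nonneg psi)]
    · exact mul_neg_of_neg_of_pos (mul_neg_of_pos_of_neg (by norm_num) (by linarith)) hD
  intro k hk
  simp only [Finset.mem_insert, Finset.mem_singleton] at hk
  rcases hk with rfl | rfl | rfl | rfl | rfl | rfl | rfl | rfl | rfl | rfl | rfl | rfl | rfl |
    rfl | rfl | rfl <;>
  first
  | assumption
  | simp only [hfam.h6, hfam.h7, hfam.h8, hfam.h9, hfam.h11, hfam.h12, hfam.h19, hfam.h24,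
      hfam.h25]
    assumption

/-! ### The equivalent equations as an acoustic operator. -/

theorem isIsotropicAcoustic_acousticOp (c0sq mu zeta xi chi eta mu4 zeta4 : ℝ) :
    IsIsotropicAcoustic (acousticOp c0sq mu zeta xi chi eta mu4 zeta4) := by
  -- Derivatives of order at most four need Laplacian powers up to two; no curl occurs.
  refine ⟨3, fun k => if k = 2 then eta else 0,
    fun k => if k = 0 then 1 else if k = 1 then xi else 0,
    fun k => if k = 0 then c0sq else if k = 1 then chi else 0,
    fun k => if k = 1 then -mu else if k = 2 then mu4 else 0,
    fun k => if k = 0 then -zeta else if k = 1 then zeta4 else 0, fun _ => 0, ?_⟩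
  rw [acousticOp, neg_inj]
  ext1 i j
  rw [Matrix.sum_apply]
  simp only [Finset.sum_range_succ, Finset.sum_range_zero, acousticBlocks, Matrix.of_apply]
  refine Fin.cases ?_ (fun i => ?_) i <;> refine Fin.cases ?_ (fun j => ?_) j
  · simp
  · simp
  · simp
  · by_cases h : i = j <;> simp [h]
    ring

theorem acousticBlocks_eq (a : MvPolynomial (Fin 3) ℝ) (b c : Fin 3 → MvPolynomial (Fin 3) ℝ)
    (D : Matrix (Fin 3) (Fin 3) (MvPolynomial (Fin 3) ℝ)) :
    acousticBlocks a b c D =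
      !![a, b 0, b 1, b 2; c 0, D 0 0, D 0 1, D 0 2; c 1, D 1 0, D 1 1, D 1 2;
        c 2, D 2 0, D 2 1, D 2 2] := by
  ext1 i j
  fin_cases i <;> fin_cases j <;> rfl

theorem symbolVec_acousticOp (c0sq mu zeta xi chi eta mu4 zeta4 : ℝ) (x : Fin 3 → ℝ)
    (c : Fin 4 → ℝ) :
    symbolVec (acousticOp c0sq mu zeta xi chi eta mu4 zeta4) x c =
      ![-(eta * (x 0 ^ 2 + x 1 ^ 2 + x 2 ^ 2) ^ 2 * c 0
          + (1 + xi * (x 0 ^ 2 + x 1 ^ 2 + x 2 ^ 2)) * (x 0 * c 1 + x 1 * c 2 + x 2 * c 3)),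
        -((c0sq + chi * (x 0 ^ 2 + x 1 ^ 2 + x 2 ^ 2)) * x 0 * c 0
          + (mu4 * (x 0 ^ 2 + x 1 ^ 2 + x 2 ^ 2) - mu) * (x 0 ^ 2 + x 1 ^ 2 + x 2 ^ 2) * c 1
          + (zeta4 * (x 0 ^ 2 + x 1 ^ 2 + x 2 ^ 2) - zeta) * x 0
            * (x 0 * c 1 + x 1 * c 2 + x 2 * c 3)),
        -((c0sq + chi * (x 0 ^ 2 + x 1 ^ 2 + x 2 ^ 2)) * x 1 * c 0
          + (mu4 * (x 0 ^ 2 + x 1 ^ 2 + x 2 ^ 2) - mu) * (x 0 ^ 2 + x 1 ^ 2 + x 2 ^ 2) * c 2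
          + (zeta4 * (x 0 ^ 2 + x 1 ^ 2 + x 2 ^ 2) - zeta) * x 1
            * (x 0 * c 1 + x 1 * c 2 + x 2 * c 3)),
        -((c0sq + chi * (x 0 ^ 2 + x 1 ^ 2 + x 2 ^ 2)) * x 2 * c 0
          + (mu4 * (x 0 ^ 2 + x 1 ^ 2 + x 2 ^ 2) - mu) * (x 0 ^ 2 + x 1 ^ 2 + x 2 ^ 2) * c 3
          + (zeta4 * (x 0 ^ 2 + x 1 ^ 2 + x 2 ^ 2) - zeta) * x 2
            * (x 0 * c 1 + x 1 * c 2 + x 2 * c 3))] := by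
  funext i
  rw [acousticOp, acousticBlocks_eq]
  fin_cases i <;>
    simp [symbolVec, Matrix.mulVec, dotProduct, Fin.sum_univ_four, Fin.sum_univ_three,
      laplacian] <;> ring

theorem symbolVec_moments_zero (lam alpha gam : ℝ) (s : Fin 27 → ℝ) (x : Fin 3 → ℝ)
    (c : Fin 4 → ℝ) :
    symbolVec ((d3q27 lam alpha gam s).moments 0) x c = d3q27EqVec lam alpha gam c := by
  funext k
  refine Fin.addCases (m := 4) (n := 23) (fun i => ?_) (fun i => ?_) k
  · simp only [symbolVec, Matrix.mulVec, dotProduct, Matrix.map_apply, moments_castAdd]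
    fin_cases i <;> simp [Matrix.one_apply, d3q27EqVec]
  · simp only [symbolVec, Matrix.mulVec, dotProduct, Matrix.map_apply, moments_natAdd, beta_zero,
      eval_C, Fin.sum_univ_four]
    fin_cases i <;> simp [d3q27, d3q27Equilibrium, d3q27EqVec]

theorem symbolVec_midpoint_succ (lam alpha gam : ℝ) (s σ : Fin 27 → ℝ)
    (hs : ∀ k : Fin 27, 4 ≤ k → s k ≠ 0) (hσ : ∀ k : Fin 27, 4 ≤ k → σ k = henon (s k))
    (x : Fin 3 → ℝ) (l : ℕ) (c : Fin 4 → ℝ) :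
    symbolVec ((d3q27 lam alpha gam s).midpoint (l + 1)) x c =
      σ * symbolVec ((d3q27 lam alpha gam s).defect (l + 1)) x c := by
  have h4 : ∀ i : Fin 23, (4 : Fin 27) ≤ Fin.natAdd 4 i := fun i => Nat.le_add_right 4 i
  funext k
  rw [Pi.mul_apply]
  refine Fin.addCases (m := 4) (n := 23) (fun i => ?_) (fun i => ?_) k
  · simp [symbolVec, Matrix.mulVec, dotProduct, midpoint_succ_castAdd, defect_castAdd]
  · simp only [symbolVec, Matrix.mulVec, dotProduct, Matrix.map_apply]
    rw [Finset.mul_sum]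
    refine Finset.sum_congr rfl fun j _ => ?_
    rw [midpoint_succ_natAdd _ (fun i => hs _ (h4 i)), hσ _ (h4 i), eval_mul, eval_C, mul_assoc]
    rfl

/-- On symbols, right multiplication by `α_l` becomes precomposition with `a l`, and the means of
positive order become `σ` times the jumps. -/
theorem isD3Q27Expansion (lam alpha gam : ℝ) (s σ : Fin 27 → ℝ) (hlam : lam ≠ 0)
    (hs : ∀ k : Fin 27, 4 ≤ k → s k ≠ 0) (hσ : ∀ k : Fin 27, 4 ≤ k → σ k = henon (s k))
    (x : Fin 3 → ℝ) :
    IsD3Q27Expansion lam alpha gam x σ (fun l => symbolVec ((d3q27 lam alpha gam s).alpha l) x)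
      (fun l => symbolVec ((d3q27 lam alpha gam s).defect l) x) := by
  have hM := isUnit_d3q27_M lam alpha gam s hlam
  have hs' : ∀ i, (d3q27 lam alpha gam s).s i ≠ 0 := fun i => hs _ (Nat.le_add_right 4 i)
  have htop : ∀ l c (i : Fin 4),
      symbolVec ((d3q27 lam alpha gam s).defect l) x c (Fin.castAdd 23 i) = 0 := fun l c i => by
    simp [symbolVec, Matrix.mulVec, dotProduct, defect_castAdd]
  have hmid := symbolVec_midpoint_succ lam alpha gam s σ hs hσ x
  have hst := symbolVec_streamingMatrix lam alpha gam s hlam x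
  have hzero : ∀ c, symbolVec ((d3q27 lam alpha gam s).midpoint 0) x c =
      d3q27EqVec lam alpha gam c := fun c => by
    rw [midpoint_zero, symbolVec_moments_zero]
  refine ⟨fun l c => htop l c 0, fun l c => htop l c 1, fun l c => htop l c 2,
    fun l c => htop l c 3, fun c => ?_, fun c => ?_, fun c => ?_, fun c => ?_⟩
  · rw [defect_one _ hM hs']
    simp only [symbolVec_sub, symbolVec_mul, hst, hzero]
  · rw [defect_two _ hM hs']
    simp only [symbolVec_sub, symbolVec_mul, hst, hzero, hmid 0]
  · rw [defect_three _ hM hs']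
    simp only [symbolVec_sub, symbolVec_add, symbolVec_smul, symbolVec_mul, hst, hzero, hmid 0,
      hmid 1]
  · rw [defect_four _ hM hs']
    simp only [symbolVec_sub, symbolVec_add, symbolVec_smul, symbolVec_mul, hst, hzero, hmid 0,
      hmid 1, hmid 2]

end

theorem mainTheorem3 (lam dt dx alpha gam psi : ℝ) (s σ : Fin 27 → ℝ)
    (hlam : 0 < lam) (hdt : 0 < dt) (hdx : dx = lam * dt)
    (hs : ∀ k : Fin 27, 4 ≤ k → s k ≠ 0)
    (hσ : ∀ k : Fin 27, 4 ≤ k → σ k = henon (s k))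
    (halpha : 2 + 3 * alpha ≠ 0) (hpsi : 4 * psi - 7 ≠ 0) (hcubic : cubicD psi ≠ 0)
    (hfam : IsFourthOrderFamily alpha psi σ) :
    IsUnit (d3q27 lam alpha gam s).M ∧
    IsIsotropicAcoustic ((d3q27 lam alpha gam s).equivalentOp dt 4) ∧
    (d3q27 lam alpha gam s).equivalentOp dt 4 =
      acousticOp
        ((alpha + 2) / 3 * lam ^ 2)
        (1 / 3 * σ 5 * lam * dx)
        ((σ 5 - σ 4 * (1 + 3 * alpha)) / 9 * lam * dx)
        ((alpha - 1) / 36 * dx ^ 2)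
        ((alpha + 2) / 54 *
          (1 - alpha + 6 * alpha * σ 4 ^ 2 + 2 * σ 4 ^ 2 - 8 * σ 5 ^ 2) * lam ^ 2 * dx ^ 2)
        (etaCoeff lam dx alpha psi (σ 5))
        (mu4Coeff lam dx psi (σ 5))
        (zeta4Coeff lam dx alpha psi (σ 5)) ∧
    (-1 ≤ alpha → alpha < -(2 / 3) → psi < 7 / 4 → FamilyPositive σ →
      0 < psi ∧ psi < 3 / 2 ∧ 1 ≤ σ 4 / σ 5 ∧ σ 4 / σ 5 < 16 / 7 ∧
        (σ 4 / σ 5 = 1 ↔ psi = 1)) ∧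
    (alpha = -1 → 0 < σ 5 → 0 < psi → psi ≤ 149 / 100 → FamilyPositive σ) := by
  subst hdx
  have hlam0 := hlam.ne'
  have hQ := (quadD_pos psi).ne'
  have hT : σ 18 = psi * σ 5 := by rw [hfam.hpsi]; field_simp [hfam.h5]
  have e : IsIsotropicFourthOrder alpha (σ 4) (σ 5) (σ 10) (σ 16) (σ 18) (σ 23) (σ 26) _ _ :=
    isIsotropicFourthOrder_family halpha hpsi hcubic hQ hfam.h5 rfl rfl rfl hT hfam.h4 hfam.h10
      hfam.h23 hfam.h26 hfam.h16 rfl rfl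
  have main : (d3q27 lam alpha gam s).equivalentOp dt 4 = acousticOp
        ((alpha + 2) / 3 * lam ^ 2)
        (1 / 3 * σ 5 * lam * (lam * dt))
        ((σ 5 - σ 4 * (1 + 3 * alpha)) / 9 * lam * (lam * dt))
        ((alpha - 1) / 36 * (lam * dt) ^ 2)
        ((alpha + 2) / 54 *
          (1 - alpha + 6 * alpha * σ 4 ^ 2 + 2 * σ 4 ^ 2 - 8 * σ 5 ^ 2) * lam ^ 2 * (lam * dt) ^ 2)
        (etaCoeff lam (lam * dt) alpha psi (σ 5))
        (mu4Coeff lam (lam * dt) psi (σ 5))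
        (zeta4Coeff lam (lam * dt) alpha psi (σ 5)) := by
    refine LBScheme.ext_symbolVec fun x c => ?_
    have h := isD3Q27Expansion lam alpha gam s σ hlam0 hs hσ x
    have a1 := h.alpha_one c
    have a2 := h.alpha_two hfam.h6 hfam.h7 hfam.h8 hfam.h9 c
    have a3 := h.alpha_three hfam.h6 hfam.h7 hfam.h8 hfam.h9 hfam.h19 c
    have a4 := h.alpha_four hfam.h6 hfam.h7 hfam.h8 hfam.h9 hfam.h11 hfam.h12 hfam.h19 hfam.h24
      hfam.h25 e c
    -- The mass row at order four depends only on `σ 4` and `σ 5`; inserting the family value of `σ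
    -- 4` produces the stated `η`.
    have heta : etaCoeff lam (lam * dt) alpha psi (σ 5) =
        -(lam ^ 4 * dt ^ 3 * ((alpha + 2) / 324 * (4 * σ 5 - (3 * alpha + 1) * σ 4))) := by
      rw [hfam.h4, etaCoeff]
      field_simp
      rw [cubicD]
      ring
    have hop : LBScheme.symbolVec ((d3q27 lam alpha gam s).equivalentOp dt 4) x c =
        LBScheme.symbolVec ((d3q27 lam alpha gam s).alpha 1) x c
          + dt • LBScheme.symbolVec ((d3q27 lam alpha gam s).alpha 2) x c
          + dt ^ 2 • LBScheme.symbolVec ((d3q27 lam alpha gam s).alpha 3) x c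
          + dt ^ 3 • LBScheme.symbolVec ((d3q27 lam alpha gam s).alpha 4) x c := by
      have h1 : Finset.Icc 1 4 = ({1, 2, 3, 4} : Finset ℕ) := rfl
      simp [LBScheme.equivalentOp, h1, LBScheme.symbolVec_add, LBScheme.symbolVec_smul, add_assoc]
    rw [hop, a1, a2, a3, a4, symbolVec_acousticOp, heta, mu4Coeff, zeta4Coeff]
    funext i
    simp only [Pi.add_apply, Pi.smul_apply, smul_eq_mul]
    fin_cases i <;> simp <;> ring
  refine ⟨isUnit_d3q27_M lam alpha gam s hlam0, ?_, main, hfam.bounds_of_positive, ?_⟩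
  · rw [main]
    exact isIsotropicAcoustic_acousticOp _ _ _ _ _ _ _ _
  · rintro rfl hS h0 h1
    exact hfam.positive hS h0 h1
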